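/- **Setting.** Fix an arbitrary relation "neighboring" on a set of datasets. For $\varepsilon,\delta\ge 0$, two probability distributions $P,Q$ are $(\varepsilon,\delta)$-indistinguishable if $P(S)\le e^{\varepsilon}Q(S)+\delta$ and $Q(S)\le e^{\varepsilon}P(S)+\delta$ for every measurable set $S$; we write $P\approx_\varepsilon Q$ when $\delta=0$. A randomized algorithm $\mathcal A$ is $(\varepsilon,\delta)$-DP if $\mathcal A(D^0)$ and $\mathcal A(D^1)$ are $(\varepsilon,\delta)$-indistinguishable for all neighboring datasets $D^0,D^1$. Let $q\in(0,1]$, $\varepsilon>0$ and $\delta\in[0,1)$. A set $\top$ of outcomes is a *$q$-target with $(\varepsilon,\delta)$* of $\mathcal A$ if for all neighboring $D^0,D^1$ there are $p\in[0,1]$ and probability distributions $\mathbf C,\mathbf B^0,\mathbf B^1,\mathbf E^0,\mathbf E^1$ such that, for $b\in\{0,1\}$, $$\mathcal A(D^b)\equiv(1-\delta)\bigl(p\,\mathbf C+(1-p)\,\mathbf B^b\bigr)+\delta\,\mathbf E^b,$$ with $\mathbf B^0\approx_\varepsilon\mathbf B^1$ and $\min\bigl(\Pr[\mathbf B^0\in\top],\Pr[\mathbf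 B^1\in\top]\bigr)\ge q$. **Target charging with approximate-DP calls.** The input is a dataset $D$, an integer $\tau\ge1$, a limit $\tau_\delta\ge0$, and $q\in(0,1]$. Initialize $C\gets0$ and $C_\delta\gets0$. In round $i=1,2,\dots$ a request $(\mathcal A_i,\top_i,\delta_i)$ is received, where $\delta_i\in[0,1)$ and $\top_i$ is a $q$-target with $(\varepsilon,\delta_i)$ of $\mathcal A_i$ (in particular $\mathcal A_i$ is $(\varepsilon,\delta_i)$-DP). If $C_\delta+\delta_i>\tau_\delta$, halt. Otherwise set $C_\delta\gets C_\delta+\delta_i$, draw a fresh $r\sim\mathcal A_i(D)$ and publish $r$; if $r\in\top_i$ set $C\gets C+1$, and halt if now $C=\tau$. The requests are chosen adaptively by an analyst, possibly randomized, who sees all earlier requests and all published outcomes, but not $D$. The output of the algorithm is the whole (possibly infinite) sequence of requests and published outcomes. **Theorem (privacy of target charging).** The value $C_\delta$ computed by the algorithm never exceeds $\tau_\delta$ (almost surely, on every dataset). Moreover, against every analyst, let $C_\delta$ now denote any number that on every dataset bounds the value computed by the algorithm almost surely (for example $\tau_\delta$), and for $\alpha>0$ put $$\delta^*(\tau,\alpha)=\exp\Bigl(-\frac{\alpha^2}{2(1+\alpha)}\,\tau\Bigr).$$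 Then the algorithm is $$\Bigl((1+\alpha)\frac{\tau}{q}\,\varepsilon,\ \ C_\delta+\delta^*(\tau,\alpha)\Bigr)\text{-DP}\qquad\text{for every }\alpha>0,$$ and it is also $$\Bigl(\tfrac12(1+\alpha)\frac{\tau}{q}\,\varepsilon^2+\varepsilon\sqrt{2(1+\alpha)\frac{\tau}{q}\log(1/\delta)},\ \ \delta+C_\delta+\delta^*(\tau,\alpha)\Bigr)\text{-DP}\qquad\text{for every }\delta>0\text{ and }\alpha>0$$ (for $\delta\ge1$ the square root is read as $0$, and the claim is trivial). -/

import Mathlib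

open MeasureTheory ProbabilityTheory

/-! ### Differential privacy -/

/-- Two distributions are `(ε, δ)`-indistinguishable. -/
def Indist {Y : Type*} [MeasurableSpace Y] (ε δ : ℝ) (P Q : Measure Y) : Prop :=
  ∀ S : Set Y, MeasurableSet S →
    P.real S ≤ Real.exp ε * Q.real S + δ ∧ Q.real S ≤ Real.exp ε * P.real S + δ

/-- A randomized algorithm, given by its output distribution on every dataset, is `(ε, δ)`-DP with
respect to the neighboring relation `nbr` on datasets. -/
def IsDP {𝒟 Y : Type*} [MeasurableSpace Y] (nbr : 𝒟 → 𝒟 → Prop) (ε δ : ℝ)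
    (A : 𝒟 → Measure Y) : Prop :=
  ∀ D₀ D₁ : 𝒟, nbr D₀ D₁ → Indist ε δ (A D₀) (A D₁)

/-- `T` is a `q`-target with `(ε, δ)` of the pair of distributions `(Z₀, Z₁)`. -/
def IsTargetOfPair {Y : Type*} [MeasurableSpace Y] (q ε δ : ℝ) (T : Set Y)
    (Z₀ Z₁ : Measure Y) : Prop :=
  ∃ (p : ℝ) (C B₀ B₁ E₀ E₁ : Measure Y),
    0 ≤ p ∧ p ≤ 1 ∧
    IsProbabilityMeasure C ∧ IsProbabilityMeasure B₀ ∧ IsProbabilityMeasure B₁ ∧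
    IsProbabilityMeasure E₀ ∧ IsProbabilityMeasure E₁ ∧
    Z₀ = ENNReal.ofReal (1 - δ) • (ENNReal.ofReal p • C + ENNReal.ofReal (1 - p) • B₀) +
      ENNReal.ofReal δ • E₀ ∧
    Z₁ = ENNReal.ofReal (1 - δ) • (ENNReal.ofReal p • C + ENNReal.ofReal (1 - p) • B₁) +
      ENNReal.ofReal δ • E₁ ∧
    Indist ε 0 B₀ B₁ ∧ q ≤ min (B₀.real T) (B₁.real T)

/-- `T` is a `q`-target with `(ε, δ)` of the randomized algorithm `A`. -/
def IsTarget {𝒟 Y : Type*} [MeasurableSpace Y] (nbr : 𝒟 → 𝒟 → Prop) (q ε δ : ℝ) (T : Set Y)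
    (A : 𝒟 → Measure Y) : Prop :=
  ∀ D₀ D₁ : 𝒟, nbr D₀ D₁ → IsTargetOfPair q ε δ T (A D₀) (A D₁)

/-! ### The interaction -/

/-- The requests that may be sent to the algorithm. The request `m : M` consists of the randomized
algorithm `D ↦ alg D m`, the target `{y | (m, y) ∈ target}` and the parameter `delta m`. -/
structure Requests (𝒟 M Y : Type*) [MeasurableSpace M] [MeasurableSpace Y] where
  alg : 𝒟 → Kernel M Y
  isMarkovKernel_alg : ∀ D, IsMarkovKernel (alg D)
  target : Set (M × Y)
  measurableSet_target : MeasurableSet target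
  delta : M → ℝ
  measurable_delta : Measurable delta

/-- What is visible of one round: the request received, and the reply, which is either a published
outcome `Sum.inl y` or `Sum.inr ()` (nothing is published, the algorithm has halted). -/
abbrev Round (M Y : Type*) : Type _ := M × (Y ⊕ Unit)

/-- An adaptive and possibly randomized analyst: the first request is drawn from `first`, and
request number `n + 1` is drawn from `next n`, given everything visible in the rounds
`0, …, n`. -/
structure Analyst (M Y : Type*) [MeasurableSpace M] [MeasurableSpace Y] where
  first : Measure M
  isProbabilityMeasure_first : IsProbabilityMeasure first
  next : (n : ℕ) → Kernel ((i : Finset.Iic n) → Round M Y) M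
  isMarkovKernel_next : ∀ n, IsMarkovKernel (next n)

namespace Requests

variable {𝒟 M Y : Type*} [MeasurableSpace M] [MeasurableSpace Y] (K : Requests 𝒟 M Y)
variable {ι : Type*} [Fintype ι]

/-- The rounds in which a published outcome hits the target of the request. -/
def hitSet : Set (Round M Y) :=
  (Prod.map id Sum.inl) '' K.target

/-- The charge of a round to the `δ`-budget: `δ_i` if an outcome was published, `0` otherwise. -/
def charge (r : Round M Y) : ℝ :=
  Sum.elim (fun _ => K.delta r.1) (fun _ => 0) r.2

open Classical in
/-- The counter `C` of target hits after the rounds `h`. -/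
noncomputable def hits (h : ι → Round M Y) : ℕ :=
  ∑ i, if h i ∈ K.hitSet then 1 else 0

/-- The cumulative parameter `C_δ` after the rounds `h`. -/
def spent (h : ι → Round M Y) : ℝ :=
  ∑ i, K.charge (h i)

/-- The pairs of a history and a new request for which an outcome is published: the algorithm has
not halted before (it has replied in all rounds, with fewer than `τ` target hits) and the request
does not make it halt by exceeding the limit `τδ`. -/
def publishSet (τ : ℕ) (τδ : ℝ) : Set ((ι → Round M Y) × M) :=
  {x | (∀ i, (x.1 i).2.isLeft = true) ∧ K.hits x.1 < τ ∧ K.spent x.1 + K.delta x.2 ≤ τδ}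

theorem measurableEmbedding_inl : MeasurableEmbedding (Sum.inl : Y → Y ⊕ Unit) :=
  ⟨Sum.inl_injective, measurable_inl, fun _ hs => measurableSet_inl_image.2 hs⟩

theorem measurableSet_hitSet : MeasurableSet K.hitSet :=
  (MeasurableEmbedding.id.prodMap measurableEmbedding_inl).measurableSet_image.2
    K.measurableSet_target

theorem measurable_charge : Measurable K.charge := by
  have h : MeasurableSet {r : Round M Y | r.2 ∈ Set.range Sum.inl} :=
    measurable_snd measurableSet_range_inl
  classical
  have e : K.charge = fun r => if r ∈ {r : Round M Y | r.2 ∈ Set.range Sum.inl}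
      then K.delta r.1 else 0 := by
    funext ⟨m, y⟩
    rcases y with y | y <;> simp [charge]
  rw [e]
  exact Measurable.ite h (K.measurable_delta.comp measurable_fst) measurable_const

theorem measurableSet_publishSet (τ : ℕ) (τδ : ℝ) :
    MeasurableSet (K.publishSet (ι := ι) τ τδ) := by
  have h1 : MeasurableSet {x : (ι → Round M Y) × M | ∀ i, (x.1 i).2.isLeft = true} := by
    rw [Set.ofPred_forall]
    refine MeasurableSet.iInter fun i => ?_
    have h : MeasurableSet (Set.range (Sum.inl : Y → Y ⊕ Unit)) :=
      measurableSet_range_inl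
    have e : {x : (ι → Round M Y) × M | (x.1 i).2.isLeft = true} =
        (fun x : (ι → Round M Y) × M => (x.1 i).2) ⁻¹' Set.range Sum.inl := by
      ext x
      change (x.1 i).2.isLeft = true ↔ ∃ y, Sum.inl y = (x.1 i).2
      cases (x.1 i).2 <;> simp
    rw [e]
    exact (by fun_prop : Measurable fun x : (ι → Round M Y) × M => (x.1 i).2) h
  have h2 : MeasurableSet {x : (ι → Round M Y) × M | K.hits x.1 < τ} := by
    have : Measurable fun x : (ι → Round M Y) × M => K.hits x.1 := by
      unfold hits
      refine Finset.measurable_sum _ fun i _ => ?_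
      refine Measurable.ite ?_ measurable_const measurable_const
      exact (by fun_prop : Measurable fun x : (ι → Round M Y) × M => x.1 i)
        K.measurableSet_hitSet
    exact measurableSet_lt this measurable_const
  have h3 : MeasurableSet
      {x : (ι → Round M Y) × M | K.spent x.1 + K.delta x.2 ≤ τδ} := by
    have : Measurable fun x : (ι → Round M Y) × M => K.spent x.1 + K.delta x.2 := by
      unfold spent
      refine Measurable.add (Finset.measurable_sum _ fun i _ => ?_)
        (K.measurable_delta.comp measurable_snd)
      exact K.measurable_charge.comp (by fun_prop)
    exact measurableSet_le this measurable_const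
  exact h1.inter (h2.inter h3)

open Classical in
/-- The reply to a request on dataset `D`, given the history: a fresh sample of the requested
algorithm on `D` is published, unless the algorithm has halted or halts now. -/
noncomputable def reply (τ : ℕ) (τδ : ℝ) (D : 𝒟) : Kernel ((ι → Round M Y) × M) (Y ⊕ Unit) :=
  Kernel.piecewise (K.measurableSet_publishSet τ τδ)
    (((K.alg D).comap Prod.snd measurable_snd).map Sum.inl)
    (Kernel.const _ (Measure.dirac (Sum.inr ())))

instance (D : 𝒟) : IsMarkovKernel (K.alg D) := K.isMarkovKernel_alg D

instance (τ : ℕ) (τδ : ℝ) (D : 𝒟) : IsMarkovKernel (K.reply (ι := ι) τ τδ D) := by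
  let κ : Kernel ((ι → Round M Y) × M) Y := (K.alg D).comap Prod.snd measurable_snd
  have : IsMarkovKernel (κ.map (Sum.inl : Y → Y ⊕ Unit)) :=
    Kernel.IsMarkovKernel.map κ measurable_inl
  unfold reply
  infer_instance

end Requests

namespace Analyst

variable {𝒟 M Y : Type*} [MeasurableSpace M] [MeasurableSpace Y] (A : Analyst M Y)

instance : IsProbabilityMeasure A.first := A.isProbabilityMeasure_first

instance (n : ℕ) : IsMarkovKernel (A.next n) := A.isMarkovKernel_next n

/-- The law of round `0` (the history is empty). -/
noncomputable def firstRound (K : Requests 𝒟 M Y) (τ : ℕ) (τδ : ℝ) (D : 𝒟) :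
    Measure (Round M Y) :=
  A.first ⊗ₘ ((K.reply (ι := Fin 0) τ τδ D).comap (fun m => (Fin.elim0, m)) (by fun_prop))

/-- The law of round `n + 1` given the rounds `0, …, n`. -/
noncomputable def nextRound (K : Requests 𝒟 M Y) (τ : ℕ) (τδ : ℝ) (D : 𝒟) (n : ℕ) :
    Kernel ((i : Finset.Iic n) → Round M Y) (Round M Y) :=
  A.next n ⊗ₖ K.reply τ τδ D

instance (K : Requests 𝒟 M Y) (τ : ℕ) (τδ : ℝ) (D : 𝒟) :
    IsProbabilityMeasure (A.firstRound K τ τδ D) := by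
  unfold firstRound
  infer_instance

instance (K : Requests 𝒟 M Y) (τ : ℕ) (τδ : ℝ) (D : 𝒟) (n : ℕ) :
    IsMarkovKernel (A.nextRound K τ τδ D n) := by
  unfold nextRound
  infer_instance

end Analyst

/-- Target charging with approximate-DP calls, with limit `τ` on the number of target hits and limit
`τδ` on the cumulative `δ`-parameter, run on the dataset `D` in interaction with the analyst `A`:
the law of the whole visible interaction (all requests and all published outcomes). -/
noncomputable def targetCharging {𝒟 M Y : Type*} [MeasurableSpace M] [MeasurableSpace Y]
    (K : Requests 𝒟 M Y) (A : Analyst M Y) (τ : ℕ) (τδ : ℝ) (D : 𝒟) :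
    Measure (ℕ → Round M Y) :=
  Kernel.trajMeasure (X := fun _ => Round M Y) (A.firstRound K τ τδ D) (A.nextRound K τ τδ D)

instance {𝒟 M Y : Type*} [MeasurableSpace M] [MeasurableSpace Y]
    (K : Requests 𝒟 M Y) (A : Analyst M Y) (τ : ℕ) (τδ : ℝ) (D : 𝒟) :
    IsProbabilityMeasure (targetCharging K A τ τδ D) := by
  unfold targetCharging
  infer_instance

/-- The cumulative parameter `C_δ` computed by the algorithm in an interaction stays at most `c`. -/
def SpentAtMost {𝒟 M Y : Type*} [MeasurableSpace M] [MeasurableSpace Y]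
    (K : Requests 𝒟 M Y) (c : ℝ) (ω : ℕ → Round M Y) : Prop :=
  ∀ n : ℕ, K.spent (fun i : Fin n => ω i) ≤ c

open scoped ENNReal

/-! Fix neighbours `D₀`, `D₁` and call a round a B-call when its outcome comes from the `B`
component of the target decomposition. A `C` outcome has the same law on both datasets and costs
nothing, an `E` outcome costs at most `δ_i` in total variation, and only B-calls create privacy
loss. Each B-call hits its target with probability at least `q`, so more than about `(1 + α) τ / q`
of them before `τ` hits is unlikely. What remains is ordinary composition of that many `ε`-DP calls.

The components are not visible in the transcript, and no coupling is built to expose them. Instead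
one inequality is propagated backwards through the rounds, for every `k` and every `x` at once:
given the history `h`, `P₀(S) ≤ x P₁(S) + E₀[future charges] + G a ^ hits(h) b ^ k + w k x`. Here
`k` is a budget of B-calls, `x` is the remaining likelihood-ratio allowance, `a = 1 / (1 + α)` and
`b = 1 - q + q a`. The third term is an exponential potential for exhausting the budget: a B-call
multiplies `a ^ hits` by at most `b` on average. The last term is a potential for excessive privacy
loss. Since `k` and `x` are universally quantified, the step may keep `(k, x)` on the `C` component
and pass to `(k - 1, x / ρ(y))` on the `B` component, where `ρ = dB₀/dB₁`. This step is
`lintegral_target_le`; `Analyst.run_preimage_le` is the induction.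

The two privacy bounds differ only in `w`: a threshold at `exp (k ε)` for basic composition
(`isLossPotential_pure`), and a moment bound in the style of Rényi divergence for advanced
composition (`isLossPotential_renyi`). The induction treats events of finitely many rounds;
`measure_le_of_preimage_frestrictLe_le` extends the result to all events. -/

theorem Indist.symm {Y : Type*} [MeasurableSpace Y] {ε δ : ℝ} {P Q : Measure Y}
    (h : Indist ε δ P Q) : Indist ε δ Q P :=
  fun S hS => ⟨(h S hS).2, (h S hS).1⟩

theorem IsTargetOfPair.symm {Y : Type*} [MeasurableSpace Y] {q ε δ : ℝ} {T : Set Y}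
    {Z₀ Z₁ : Measure Y} (h : IsTargetOfPair q ε δ T Z₀ Z₁) : IsTargetOfPair q ε δ T Z₁ Z₀ := by
  obtain ⟨p, C, B₀, B₁, E₀, E₁, h0, h1, hC, hB₀, hB₁, hE₀, hE₁, e₀, e₁, hB, hq⟩ := h
  exact ⟨p, C, B₁, B₀, E₁, E₀, h0, h1, hC, hB₁, hB₀, hE₁, hE₀, e₁, e₀, hB.symm, by
    rwa [min_comm]⟩

/-- A potential bounding the probability that the privacy loss of `k` further `ε`-DP calls exceeds
`log x`. -/
structure IsLossPotential (Y : Type*) [MeasurableSpace Y] (ε : ℝ) (w : ℕ → ℝ≥0∞ → ℝ≥0∞) :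
    Prop where
  one_le : ∀ k x, x < 1 → 1 ≤ w k x
  lintegral_le : ∀ (B₀ B₁ : Measure Y) [IsProbabilityMeasure B₀] [IsProbabilityMeasure B₁],
    Indist ε 0 B₀ B₁ → ∀ k x, ∫⁻ y, w k (x / B₀.rnDeriv B₁ y) ∂B₀ ≤ w (k + 1) x

/-! ### One call: the inequality for a target decomposition. -/

section Pair

variable {Y : Type*} [MeasurableSpace Y]

theorem Indist.le_smul {ε : ℝ} {P Q : Measure Y} [IsFiniteMeasure P] [IsFiniteMeasure Q]
    (h : Indist ε 0 P Q) : P ≤ ENNReal.ofReal (Real.exp ε) • Q := by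
  refine Measure.le_iff.2 fun S hS => ?_
  have := (h S hS).1
  rw [add_zero] at this
  rw [Measure.smul_apply, smul_eq_mul, ← ofReal_measureReal, ← ofReal_measureReal,
    ← ENNReal.ofReal_mul (Real.exp_pos _).le]
  exact ENNReal.ofReal_le_ofReal this

theorem Indist.absolutelyContinuous {ε : ℝ} {P Q : Measure Y} [IsFiniteMeasure P]
    [IsFiniteMeasure Q] (h : Indist ε 0 P Q) : P ≪ Q :=
  (Measure.absolutelyContinuous_of_le h.le_smul).trans Measure.smul_absolutelyContinuous

theorem lintegral_le_one_of_le_one {P : Measure Y} [IsProbabilityMeasure P] {u : Y → ℝ≥0∞}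
    (hu : ∀ y, u y ≤ 1) : ∫⁻ y, u y ∂P ≤ 1 :=
  (lintegral_mono hu).trans (by simp)

/-- The expected factor by which one B-call changes `a ^ hits`; it decreases in the hit probability
because `a ≤ 1`. -/
theorem lintegral_hit_le {P : Measure Y} [IsProbabilityMeasure P] {T : Set Y}
    (hT : MeasurableSet T) {q a : ℝ} (ha0 : 0 ≤ a) (ha1 : a ≤ 1) (hP : q ≤ P.real T) :
    ∫⁻ y, T.indicator (fun _ => ENNReal.ofReal a) y + Tᶜ.indicator 1 y ∂P
      ≤ ENNReal.ofReal (1 - q + q * a) := by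
  rw [lintegral_add_left (measurable_const.indicator hT), lintegral_indicator_const hT,
    lintegral_indicator_one hT.compl, ← ofReal_measureReal, ← ofReal_measureReal,
    ← ENNReal.ofReal_mul ha0, ← ENNReal.ofReal_add (by positivity) (by positivity),
    probReal_compl_eq_one_sub hT]
  apply ENNReal.ofReal_le_ofReal
  nlinarith

/-- The backward step for one published call. In use, `u₀`, `u₁` are the conditional probabilities
of the event after outcome `y`, `r` is the expected later charge and `g = G a ^ hits`. Each
component of the mixture is bounded with its own choice of `k` and `x` in `h`. -/
theorem lintegral_target_le {q ε δ a : ℝ} {T : Set Y} {Z₀ Z₁ : Measure Y}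
    (hδ0 : 0 ≤ δ) (hδ1 : δ ≤ 1) (ha0 : 0 ≤ a) (ha1 : a ≤ 1) (hT : MeasurableSet T)
    (hZ : IsTargetOfPair q ε δ T Z₀ Z₁) {w : ℕ → ℝ≥0∞ → ℝ≥0∞} (hw : IsLossPotential Y ε w)
    {g : ℝ≥0∞} (hg : 1 ≤ g) {u₀ u₁ r : Y → ℝ≥0∞} (hu₀ : ∀ y, u₀ y ≤ 1)
    (mu₁ : Measurable u₁) (mr : Measurable r)
    (h : ∀ k x y, u₀ y ≤ x * u₁ y + r y +
      g * ENNReal.ofReal (1 - q + q * a) ^ k *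
        (T.indicator (fun _ => ENNReal.ofReal a) y + Tᶜ.indicator 1 y) + w k x) (k : ℕ) (x : ℝ≥0∞) :
    ∫⁻ y, u₀ y ∂Z₀ ≤ x * ∫⁻ y, u₁ y ∂Z₁ + (ENNReal.ofReal δ + ∫⁻ y, r y ∂Z₀) +
      g * ENNReal.ofReal (1 - q + q * a) ^ k + w k x := by
  obtain ⟨p, C, B₀, B₁, E₀, E₁, hp0, hp1, hC, hB₀, hB₁, hE₀, hE₁, rfl, rfl, hB, hqB⟩ := hZ
  set b := ENNReal.ofReal (1 - q + q * a)
  set t : Y → ℝ≥0∞ := fun y => T.indicator (fun _ => ENNReal.ofReal a) y + Tᶜ.indicator 1 y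
  have mt : Measurable t :=
    (measurable_const.indicator hT).add (measurable_one.indicator hT.compl)
  have ht1 : ∀ y, t y ≤ 1 := fun y => by
    by_cases hy : y ∈ T <;> simp [t, hy, ha1]
  have bC : ∫⁻ y, u₀ y ∂C ≤ x * ∫⁻ y, u₁ y ∂C + ∫⁻ y, r y ∂C + g * b ^ k + w k x := by
    calc ∫⁻ y, u₀ y ∂C ≤ ∫⁻ y, x * u₁ y + r y + g * b ^ k * t y + w k x ∂C :=
          lintegral_mono fun y => h k x y
      _ = x * ∫⁻ y, u₁ y ∂C + ∫⁻ y, r y ∂C + g * b ^ k * ∫⁻ y, t y ∂C + w k x := by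
          rw [lintegral_add_right _ measurable_const, lintegral_add_right _ (mt.const_mul _),
            lintegral_add_right _ mr, lintegral_const_mul _ mu₁, lintegral_const_mul _ mt]
          simp
      _ ≤ x * ∫⁻ y, u₁ y ∂C + ∫⁻ y, r y ∂C + g * b ^ k * 1 + w k x := by
          gcongr
          exact lintegral_le_one_of_le_one ht1
      _ = _ := by rw [mul_one]
  have bB : ∫⁻ y, u₀ y ∂B₀ ≤ x * ∫⁻ y, u₁ y ∂B₁ + ∫⁻ y, r y ∂B₀ + g * b ^ k + w k x := by
    -- With no budget left the bound is trivial, as `g ≥ 1`. Otherwise the B-call spends one unit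
    -- and the allowance becomes `x / ρ y`, so that changing measure from `B₀` to `B₁` restores the
    -- factor `x`.
    rcases k with _ | k
    · calc ∫⁻ y, u₀ y ∂B₀ ≤ 1 := lintegral_le_one_of_le_one hu₀
        _ ≤ g * b ^ 0 := by simpa using hg
        _ ≤ _ := le_add_right le_add_self
    · set ρ := B₀.rnDeriv B₁
      have mρ : Measurable ρ := Measure.measurable_rnDeriv _ _
      have m1 : Measurable fun y => x / ρ y * u₁ y := (measurable_const.div mρ).mul mu₁
      calc ∫⁻ y, u₀ y ∂B₀ ≤ ∫⁻ y, x / ρ y * u₁ y + r y + g * b ^ k * t y + w k (x / ρ y) ∂B₀ :=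
            lintegral_mono fun y => h k (x / ρ y) y
        _ = ∫⁻ y, x / ρ y * u₁ y ∂B₀ + ∫⁻ y, r y ∂B₀ + g * b ^ k * ∫⁻ y, t y ∂B₀
            + ∫⁻ y, w k (x / ρ y) ∂B₀ := by
            rw [lintegral_add_left (show Measurable fun y => x / ρ y * u₁ y + r y + g * b ^ k * t y from
                (m1.add mr).add (mt.const_mul _)),
              lintegral_add_right _ (mt.const_mul _), lintegral_add_right _ mr,
              lintegral_const_mul _ mt]
        _ ≤ x * ∫⁻ y, u₁ y ∂B₁ + ∫⁻ y, r y ∂B₀ + g * b ^ k * b + w (k + 1) x := by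
            gcongr
            · rw [← lintegral_rnDeriv_mul hB.absolutelyContinuous m1.aemeasurable,
                ← lintegral_const_mul _ mu₁]
              refine lintegral_mono fun y => ?_
              rw [← mul_assoc]
              gcongr
              exact ENNReal.mul_div_le
            · exact lintegral_hit_le hT ha0 ha1 (hqB.trans (min_le_left _ _))
            · exact hw.lintegral_le B₀ B₁ hB k x
        _ = _ := by rw [pow_succ, mul_assoc g]
  have bE : ∫⁻ y, u₀ y ∂E₀ ≤ 1 := lintegral_le_one_of_le_one hu₀
  simp only [lintegral_add_measure, lintegral_smul_measure, smul_eq_mul]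
  -- The `C` and `B` weights sum to at most `1`, so the constants `g * b ^ k + w k x` are paid once;
  -- on `E₀` the bound `u₀ ≤ 1` costs `δ`.
  have hsum : ENNReal.ofReal (1 - δ) * (ENNReal.ofReal p + ENNReal.ofReal (1 - p)) ≤ 1 := by
    rw [← ENNReal.ofReal_add hp0 (by linarith), ← ENNReal.ofReal_mul (by linarith)]
    exact ENNReal.ofReal_le_one.2 (by linarith)
  calc _ ≤ ENNReal.ofReal (1 - δ) *
        (ENNReal.ofReal p * (x * ∫⁻ y, u₁ y ∂C + ∫⁻ y, r y ∂C + g * b ^ k + w k x) +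
          ENNReal.ofReal (1 - p) *
            (x * ∫⁻ y, u₁ y ∂B₁ + ∫⁻ y, r y ∂B₀ + g * b ^ k + w k x)) +
          ENNReal.ofReal δ * 1 := by gcongr
    _ = x * (ENNReal.ofReal (1 - δ) * (ENNReal.ofReal p * ∫⁻ y, u₁ y ∂C +
          ENNReal.ofReal (1 - p) * ∫⁻ y, u₁ y ∂B₁)) +
        (ENNReal.ofReal δ + (ENNReal.ofReal (1 - δ) * (ENNReal.ofReal p * ∫⁻ y, r y ∂C +
          ENNReal.ofReal (1 - p) * ∫⁻ y, r y ∂B₀))) +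
        ENNReal.ofReal (1 - δ) * (ENNReal.ofReal p + ENNReal.ofReal (1 - p)) *
          (g * b ^ k + w k x) := by ring
    _ ≤ x * (ENNReal.ofReal (1 - δ) * (ENNReal.ofReal p * ∫⁻ y, u₁ y ∂C +
          ENNReal.ofReal (1 - p) * ∫⁻ y, u₁ y ∂B₁) + ENNReal.ofReal δ * ∫⁻ y, u₁ y ∂E₁) +
        (ENNReal.ofReal δ + (ENNReal.ofReal (1 - δ) * (ENNReal.ofReal p * ∫⁻ y, r y ∂C +
          ENNReal.ofReal (1 - p) * ∫⁻ y, r y ∂B₀) + ENNReal.ofReal δ * ∫⁻ y, r y ∂E₀)) +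
        1 * (g * b ^ k + w k x) := by
          gcongr <;> exact le_self_add
    _ = _ := by ring

end Pair

/-! ### One round: the reply of the algorithm, then averaging over the request. -/

namespace Requests

variable {𝒟 M Y : Type*} [MeasurableSpace M] [MeasurableSpace Y] (K : Requests 𝒟 M Y)
variable {ι : Type*} [Fintype ι]

theorem reply_of_mem {τ : ℕ} {τδ : ℝ} (D : 𝒟) {h : ι → Round M Y} {m : M}
    (hm : (h, m) ∈ K.publishSet τ τδ) :
    K.reply τ τδ D (h, m) = (K.alg D m).map Sum.inl := by
  classical
  rw [reply, Kernel.piecewise_apply, if_pos hm, Kernel.map_apply _ measurable_inl]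
  rfl

theorem reply_of_notMem {τ : ℕ} {τδ : ℝ} (D : 𝒟) {h : ι → Round M Y} {m : M}
    (hm : (h, m) ∉ K.publishSet τ τδ) :
    K.reply τ τδ D (h, m) = Measure.dirac (Sum.inr ()) := by
  classical
  rw [reply, Kernel.piecewise_apply, if_neg hm, Kernel.const_apply]

theorem inl_mem_hitSet {m : M} {y : Y} :
    ((m, Sum.inl y) : Round M Y) ∈ K.hitSet ↔ (m, y) ∈ K.target := by
  simp [hitSet]

theorem inr_notMem_hitSet {m : M} {u : Unit} : ((m, Sum.inr u) : Round M Y) ∉ K.hitSet := by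
  simp [hitSet]

open Classical in
-- A published round starts with fewer than `τ` hits, which is exactly when `hG` is available. An
-- unpublished round has the same deterministic reply on both datasets, no charge and no hit, so the
-- hypothesis passes through unchanged.
theorem lintegral_reply_le {q ε a τδ : ℝ} {τ : ℕ}
    (ha0 : 0 ≤ a) (ha1 : a ≤ 1)
    (hδ : ∀ m, 0 ≤ K.delta m ∧ K.delta m < 1) {D₀ D₁ : 𝒟}
    (htarget : ∀ m, IsTargetOfPair q ε (K.delta m) {y | (m, y) ∈ K.target}
      (K.alg D₀ m) (K.alg D₁ m))
    {w : ℕ → ℝ≥0∞ → ℝ≥0∞} (hw : IsLossPotential Y ε w)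
    {G : ℝ≥0∞} (hG : ∀ c < τ, 1 ≤ G * ENNReal.ofReal a ^ c)
    (h : ι → Round M Y) (m : M) {u₀ u₁ r : Y ⊕ Unit → ℝ≥0∞} (hu₀ : ∀ z, u₀ z ≤ 1)
    (mu₀ : Measurable u₀) (mu₁ : Measurable u₁) (mr : Measurable r)
    (H : ∀ k x z, u₀ z ≤ x * u₁ z + r z +
      G * ENNReal.ofReal a ^ (K.hits h + if (m, z) ∈ K.hitSet then 1 else 0) *
        ENNReal.ofReal (1 - q + q * a) ^ k + w k x) (k : ℕ) (x : ℝ≥0∞) :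
    ∫⁻ z, u₀ z ∂K.reply τ τδ D₀ (h, m) ≤ x * ∫⁻ z, u₁ z ∂K.reply τ τδ D₁ (h, m) +
      ∫⁻ z, ENNReal.ofReal (K.charge (m, z)) + r z ∂K.reply τ τδ D₀ (h, m) +
      G * ENNReal.ofReal a ^ K.hits h * ENNReal.ofReal (1 - q + q * a) ^ k + w k x := by
  have mc : Measurable fun z : Y ⊕ Unit => ENNReal.ofReal (K.charge (m, z)) :=
    (K.measurable_charge.comp measurable_prodMk_left).ennreal_ofReal
  have mcr : Measurable fun z : Y ⊕ Unit => ENNReal.ofReal (K.charge (m, z)) + r z := mc.add mr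
  by_cases hm : (h, m) ∈ K.publishSet τ τδ
  · have hT : MeasurableSet {y | (m, y) ∈ K.target} :=
      measurable_prodMk_left K.measurableSet_target
    have key := lintegral_target_le (u₀ := fun y => u₀ (Sum.inl y)) (u₁ := fun y => u₁ (Sum.inl y))
      (r := fun y => r (Sum.inl y)) (hδ m).1 (hδ m).2.le ha0 ha1 hT (htarget m) hw (hG _ hm.2.1)
      (fun y => hu₀ _) (mu₁.comp measurable_inl) (mr.comp measurable_inl)
      (fun k x y => (H k x (Sum.inl y)).trans (le_of_eq ?_)) k x
    · rw [K.reply_of_mem D₀ hm, K.reply_of_mem D₁ hm, lintegral_map mu₀ measurable_inl,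
        lintegral_map mu₁ measurable_inl, lintegral_map mcr measurable_inl]
      rw [lintegral_add_right _ (show Measurable fun y => r (Sum.inl y) from mr.comp measurable_inl)]
      simpa [charge] using key
    · rw [inl_mem_hitSet]
      by_cases hy : (m, y) ∈ K.target
      · simp only [hy, if_true, Set.indicator, Set.mem_ofPred_eq, Set.mem_compl_iff, not_true,
          if_false, add_zero]
        ring
      · simp only [hy, if_false, Set.indicator, Set.mem_ofPred_eq, Set.mem_compl_iff, not_false_iff,
          if_true, add_zero, zero_add, Pi.one_apply]
        ring
  · rw [K.reply_of_notMem D₀ hm, K.reply_of_notMem D₁ hm, lintegral_dirac' _ mu₀,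
      lintegral_dirac' _ mu₁, lintegral_dirac' _ mcr]
    have := H k x (Sum.inr ())
    rw [if_neg K.inr_notMem_hitSet] at this
    simpa [charge] using this

open Classical in
-- The law of the request given the history does not depend on the dataset, so the bound for replies
-- can be integrated with `k` and `x` fixed.
theorem lintegral_round_le {q ε a τδ : ℝ} {τ : ℕ}
    (ha0 : 0 ≤ a) (ha1 : a ≤ 1)
    (hδ : ∀ m, 0 ≤ K.delta m ∧ K.delta m < 1) {D₀ D₁ : 𝒟}
    (htarget : ∀ m, IsTargetOfPair q ε (K.delta m) {y | (m, y) ∈ K.target}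
      (K.alg D₀ m) (K.alg D₁ m))
    {w : ℕ → ℝ≥0∞ → ℝ≥0∞} (hw : IsLossPotential Y ε w)
    {G : ℝ≥0∞} (hG : ∀ c < τ, 1 ≤ G * ENNReal.ofReal a ^ c)
    (ν : Measure M) [IsProbabilityMeasure ν]
    (h : ι → Round M Y) {u₀ u₁ r : Round M Y → ℝ≥0∞} (hu₀ : ∀ z, u₀ z ≤ 1)
    (mu₀ : Measurable u₀) (mu₁ : Measurable u₁) (mr : Measurable r)
    (H : ∀ k x z, u₀ z ≤ x * u₁ z + r z +
      G * ENNReal.ofReal a ^ (K.hits h + if z ∈ K.hitSet then 1 else 0) *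
        ENNReal.ofReal (1 - q + q * a) ^ k + w k x) (k : ℕ) (x : ℝ≥0∞) :
    ∫⁻ z, u₀ z ∂(ν ⊗ₘ (K.reply τ τδ D₀).sectR h) ≤
      x * ∫⁻ z, u₁ z ∂(ν ⊗ₘ (K.reply τ τδ D₁).sectR h) +
      ∫⁻ z, ENNReal.ofReal (K.charge z) + r z ∂(ν ⊗ₘ (K.reply τ τδ D₀).sectR h) +
      G * ENNReal.ofReal a ^ K.hits h * ENNReal.ofReal (1 - q + q * a) ^ k + w k x := by
  have mcr : Measurable fun z : Round M Y => ENNReal.ofReal (K.charge z) + r z :=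
    K.measurable_charge.ennreal_ofReal.add mr
  rw [Measure.lintegral_compProd mu₀, Measure.lintegral_compProd mu₁,
    Measure.lintegral_compProd mcr]
  simp only [Kernel.sectR_apply]
  have m1 : Measurable fun m => ∫⁻ z, u₁ (m, z) ∂K.reply τ τδ D₁ (h, m) :=
    Measurable.lintegral_kernel_prod_right' (κ := (K.reply τ τδ D₁).sectR h) mu₁
  have m2 : Measurable fun m =>
      ∫⁻ z, ENNReal.ofReal (K.charge (m, z)) + r (m, z) ∂K.reply τ τδ D₀ (h, m) :=
    Measurable.lintegral_kernel_prod_right' (κ := (K.reply τ τδ D₀).sectR h) mcr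
  refine (lintegral_mono fun m => K.lintegral_reply_le ha0 ha1 hδ htarget hw hG h m
    (fun z => hu₀ (m, z)) (mu₀.comp measurable_prodMk_left) (mu₁.comp measurable_prodMk_left)
    (mr.comp measurable_prodMk_left) (fun k x z => H k x (m, z)) k x).trans (le_of_eq ?_)
  simp only [Function.comp_apply]
  rw [lintegral_add_right _ measurable_const, lintegral_add_right _ measurable_const,
    lintegral_add_right _ m2, lintegral_const_mul _ m1]
  simp

end Requests

/-! ### Markov property of trajectory measures. -/

section Trajectory

open Finset Preorder

variable {R : Type*} [MeasurableSpace R]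

/-- The history `h` of the rounds `0, …, n` followed by the round `z`. -/
def appendRound {n : ℕ} (h : Iic n → R) (z : R) : Iic (n + 1) → R :=
  IicProdIoc (X := fun _ => R) n (n + 1) (h, MeasurableEquiv.piSingleton (X := fun _ => R) n z)

theorem appendRound_apply {n : ℕ} (h : Iic n → R) (z : R) (i : Iic (n + 1)) :
    appendRound h z i = if hi : i.1 ≤ n then h ⟨i, mem_Iic.2 hi⟩ else z := by
  by_cases hi : i.1 ≤ n
  · simp [appendRound, IicProdIoc, hi]
  · simp [appendRound, IicProdIoc, hi, MeasurableEquiv.piSingleton]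

theorem measurable_appendRound {n : ℕ} (h : Iic n → R) : Measurable (appendRound h) := by
  exact measurable_IicProdIoc.comp (measurable_prodMk_left.comp
    (MeasurableEquiv.measurable (MeasurableEquiv.piSingleton (X := fun _ => R) n)))

theorem sum_appendRound {n : ℕ} {N : Type*} [AddCommMonoid N] (f : R → N) (h : Iic n → R) (z : R) :
    ∑ i, f (appendRound h z i) = ∑ i, f (h i) + f z := by
  let ω : ℕ → R := fun i => if hi : i ≤ n then h ⟨i, mem_Iic.2 hi⟩ else z
  have e1 : ∀ i : Iic (n + 1), f (appendRound h z i) = f (ω i) := fun i => by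
    rw [appendRound_apply]
  have e2 : ∀ i : Iic n, f (h i) = f (ω i) := fun i => by
    simp [ω, mem_Iic.1 i.2]
  have e3 : f z = f (ω (n + 1)) := by simp [ω]
  simp_rw [e1, e2, e3]
  rw [sum_coe_sort (Iic (n + 1)) (fun i => f (ω i)), sum_coe_sort (Iic n) (fun i => f (ω i)),
    ← Nat.range_succ_eq_Iic, ← Nat.range_succ_eq_Iic, sum_range_succ _ (n + 1)]

variable (κ : (n : ℕ) → Kernel (Iic n → R) R) [∀ n, IsMarkovKernel (κ n)]

/-- The continuation from time `n` is one step of `κ n` followed by the continuation from time `n +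
1`; this is what drives the backward induction. -/
theorem lintegral_traj_succ {n : ℕ} (h : Iic n → R) {f : (ℕ → R) → ℝ≥0∞} (hf : Measurable f) :
    ∫⁻ ω, f ω ∂Kernel.traj (X := fun _ => R) κ n h =
      ∫⁻ z, ∫⁻ ω, f ω ∂Kernel.traj (X := fun _ => R) κ (n + 1) (appendRound h z) ∂κ n h := by
  have : IsMarkovKernel ((κ n).map (MeasurableEquiv.piSingleton (X := fun _ => R) n)) :=
    Kernel.IsMarkovKernel.map _ (MeasurableEquiv.measurable _)
  have m1 : Measurable fun h' => ∫⁻ ω, f ω ∂Kernel.traj (X := fun _ => R) κ (n + 1) h' :=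
    hf.lintegral_kernel
  have mI : Measurable (IicProdIoc (X := fun _ => R) n (n + 1)) := measurable_IicProdIoc
  have m2 : Measurable fun p => ∫⁻ ω, f ω ∂Kernel.traj (X := fun _ => R) κ (n + 1)
      (IicProdIoc (X := fun _ => R) n (n + 1) p) := m1.comp mI
  rw [← Kernel.traj_comp_partialTraj (X := fun _ => R) (κ := κ) (Nat.le_succ n),
    Kernel.lintegral_comp _ _ _ hf, Kernel.partialTraj_succ_self, Kernel.lintegral_map _ mI _ m1,
    Kernel.lintegral_id_prod m2]
  exact Kernel.lintegral_map _ (MeasurableEquiv.measurable _) _ (m2.comp measurable_prodMk_left)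

theorem traj_preimage_frestrictLe {n : ℕ} (h : Iic n → R) {B : Set (Iic n → R)}
    (hB : MeasurableSet B) :
    Kernel.traj (X := fun _ => R) κ n h (frestrictLe (π := fun _ => R) n ⁻¹' B) =
      B.indicator 1 h := by
  rw [← Kernel.map_apply' _ (measurable_frestrictLe n) _ hB, Kernel.traj_map_frestrictLe,
    Kernel.partialTraj_self, Kernel.id_apply, Measure.dirac_apply' _ hB]

theorem lintegral_traj_eval {n : ℕ} (h : Iic n → R) {f : R → ℝ≥0∞} (hf : Measurable f) :
    ∫⁻ ω, f (ω n) ∂Kernel.traj (X := fun _ => R) κ n h = f (h ⟨n, mem_Iic.2 le_rfl⟩) := by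
  have hf' : Measurable fun ω : ℕ → R => f (ω n) := hf.comp (measurable_pi_apply n)
  rw [Kernel.lintegral_traj (X := fun _ => R) h hf']
  simp [Function.updateFinset]

end Trajectory

/-! ### Backward induction over the rounds of the interaction. -/

section Interaction

open Finset Preorder

variable {𝒟 M Y : Type*} [MeasurableSpace M] [MeasurableSpace Y]

namespace Requests

variable (K : Requests 𝒟 M Y)

open Classical in
theorem hits_appendRound {n : ℕ} (h : Iic n → Round M Y) (z : Round M Y) :
    K.hits (appendRound h z) = K.hits h + if z ∈ K.hitSet then 1 else 0 :=
  sum_appendRound (fun r => if r ∈ K.hitSet then 1 else 0) h z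

end Requests

namespace Analyst

variable (K : Requests 𝒟 M Y) (A : Analyst M Y) (τ : ℕ) (τδ : ℝ) (D : 𝒟)

/-- The law of the interaction given the rounds `0, …, n`. -/
noncomputable def run (n : ℕ) : Kernel (Iic n → Round M Y) (ℕ → Round M Y) :=
  Kernel.traj (X := fun _ => Round M Y) (A.nextRound K τ τδ D) n

instance (n : ℕ) : IsMarkovKernel (A.run K τ τδ D n) := by
  unfold run
  infer_instance

/-- The expected charge of the rounds after round `n`, given the rounds `0, …, n`. -/
noncomputable def futureCharge (n : ℕ) (h : Iic n → Round M Y) : ℝ≥0∞ :=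
  ∫⁻ ω, ∑' i, ENNReal.ofReal (K.charge (ω (n + 1 + i))) ∂A.run K τ τδ D n h

theorem nextRound_apply (n : ℕ) (h : Iic n → Round M Y) :
    A.nextRound K τ τδ D n h = A.next n h ⊗ₘ (K.reply τ τδ D).sectR h := by
  rw [nextRound, Kernel.compProd_apply_eq_compProd_sectR]

theorem measurable_tsum_charge (n : ℕ) :
    Measurable fun ω : ℕ → Round M Y => ∑' i, ENNReal.ofReal (K.charge (ω (n + i))) :=
  Measurable.tsum fun _ => (K.measurable_charge.comp (measurable_pi_apply _)).ennreal_ofReal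

theorem measurable_futureCharge (n : ℕ) : Measurable (A.futureCharge K τ τδ D n) :=
  (measurable_tsum_charge K (n + 1)).lintegral_kernel

theorem lintegral_tsum_charge (n : ℕ) (h : Iic n → Round M Y) :
    ∫⁻ ω, ∑' i, ENNReal.ofReal (K.charge (ω (n + i))) ∂A.run K τ τδ D n h =
      ENNReal.ofReal (K.charge (h ⟨n, mem_Iic.2 le_rfl⟩)) + A.futureCharge K τ τδ D n h := by
  have e : ∀ ω : ℕ → Round M Y, ∑' i, ENNReal.ofReal (K.charge (ω (n + i))) =
      ENNReal.ofReal (K.charge (ω n)) + ∑' i, ENNReal.ofReal (K.charge (ω (n + 1 + i))) :=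
    fun ω => by
      have := tsum_eq_zero_add' (f := fun i => ENNReal.ofReal (K.charge (ω (n + i))))
        ENNReal.summable
      simpa only [add_zero, add_assoc, add_comm 1] using this
  simp_rw [e]
  rw [lintegral_add_right _ (measurable_tsum_charge K (n + 1)), run,
    lintegral_traj_eval _ h K.measurable_charge.ennreal_ofReal]
  rfl

theorem futureCharge_eq (n : ℕ) (h : Iic n → Round M Y) :
    A.futureCharge K τ τδ D n h =
      ∫⁻ z, ENNReal.ofReal (K.charge z) + A.futureCharge K τ τδ D (n + 1) (appendRound h z)
        ∂A.nextRound K τ τδ D n h := by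
  rw [futureCharge, run, lintegral_traj_succ _ h (measurable_tsum_charge K (n + 1))]
  refine lintegral_congr fun z => ?_
  refine (A.lintegral_tsum_charge K τ τδ D (n + 1) (appendRound h z)).trans ?_
  simp [appendRound_apply]

theorem run_eq (n : ℕ) (h : Iic n → Round M Y) {S : Set (ℕ → Round M Y)} (hS : MeasurableSet S) :
    A.run K τ τδ D n h S =
      ∫⁻ z, A.run K τ τδ D (n + 1) (appendRound h z) S ∂A.nextRound K τ τδ D n h := by
  have := lintegral_traj_succ (A.nextRound K τ τδ D) h (measurable_one.indicator hS)
  simp only [lintegral_indicator_one hS] at this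
  exact this

theorem measurable_run_appendRound (n : ℕ) (h : Iic n → Round M Y) {S : Set (ℕ → Round M Y)}
    (hS : MeasurableSet S) : Measurable fun z => A.run K τ τδ D (n + 1) (appendRound h z) S :=
  ((A.run K τ τδ D (n + 1)).measurable_coe hS).comp (measurable_appendRound h)

variable {K τ τδ} {q ε a : ℝ} {D₀ D₁ : 𝒟} {w : ℕ → ℝ≥0∞ → ℝ≥0∞} {G : ℝ≥0∞}

theorem run_preimage_le (ha0 : 0 ≤ a) (ha1 : a ≤ 1)
    (hδ : ∀ m, 0 ≤ K.delta m ∧ K.delta m < 1)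
    (htarget : ∀ m, IsTargetOfPair q ε (K.delta m) {y | (m, y) ∈ K.target}
      (K.alg D₀ m) (K.alg D₁ m))
    (hw : IsLossPotential Y ε w) (hG : ∀ c < τ, 1 ≤ G * ENNReal.ofReal a ^ c)
    {N : ℕ} {B : Set (Iic N → Round M Y)} (hB : MeasurableSet B) (d n : ℕ) (hn : n + d = N)
    (h : Iic n → Round M Y) (k : ℕ) (x : ℝ≥0∞) :
    A.run K τ τδ D₀ n h (frestrictLe (π := fun _ => Round M Y) N ⁻¹' B) ≤
      x * A.run K τ τδ D₁ n h (frestrictLe (π := fun _ => Round M Y) N ⁻¹' B) +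
      A.futureCharge K τ τδ D₀ n h +
      G * ENNReal.ofReal a ^ K.hits h * ENNReal.ofReal (1 - q + q * a) ^ k + w k x := by
  -- Induction on the number of rounds left before the horizon `N`. Both `k` and `x` must stay
  -- general, since the step uses the next bound with a smaller budget and an outcome-dependent
  -- allowance.
  induction d generalizing n k x with
  | zero =>
    obtain rfl : n = N := hn
    rw [run, run, traj_preimage_frestrictLe _ _ hB, traj_preimage_frestrictLe _ _ hB]
    by_cases hh : h ∈ B
    · simp only [Set.indicator_of_mem hh, Pi.one_apply, mul_one]
      -- At the horizon both probabilities are the same indicator: an allowance `x ≥ 1` suffices,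
      -- and for `x < 1` the potential is already at least `1`.
      rcases lt_or_ge x 1 with hx | hx
      · exact (hw.one_le k x hx).trans le_add_self
      · exact hx.trans (by rw [add_assoc, add_assoc]; exact le_self_add)
    · simp [Set.indicator_of_notMem hh]
  | succ d ih =>
    have hS : MeasurableSet (frestrictLe (π := fun _ => Round M Y) N ⁻¹' B) :=
      measurable_frestrictLe N hB
    rw [A.run_eq K τ τδ D₀ n h hS, A.run_eq K τ τδ D₁ n h hS, futureCharge_eq, nextRound_apply,
      nextRound_apply]
    refine K.lintegral_round_le ha0 ha1 hδ htarget hw hG (A.next n h) h (fun z => prob_le_one)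
      (A.measurable_run_appendRound K τ τδ D₀ n h hS)
      (A.measurable_run_appendRound K τ τδ D₁ n h hS)
      ((A.measurable_futureCharge K τ τδ D₀ (n + 1)).comp (measurable_appendRound h))
      (fun k x z => ?_) k x
    rw [← K.hits_appendRound]
    exact ih (n + 1) (by omega) (appendRound h z) k x

theorem lintegral_targetCharging {f : (ℕ → Round M Y) → ℝ≥0∞} (hf : Measurable f) :
    ∫⁻ ω, f ω ∂targetCharging K A τ τδ D =
      ∫⁻ z, ∫⁻ ω, f ω ∂A.run K τ τδ D 0 (fun _ => z) ∂A.firstRound K τ τδ D := by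
  rw [targetCharging, Kernel.trajMeasure, Measure.lintegral_bind (Kernel.aemeasurable _)
    hf.aemeasurable, lintegral_map hf.lintegral_kernel (MeasurableEquiv.measurable _)]
  refine lintegral_congr fun z => ?_
  rw [run]
  congr 2

theorem targetCharging_apply {S : Set (ℕ → Round M Y)} (hS : MeasurableSet S) :
    targetCharging K A τ τδ D S =
      ∫⁻ z, A.run K τ τδ D 0 (fun _ => z) S ∂A.firstRound K τ τδ D := by
  have := A.lintegral_targetCharging (K := K) (τ := τ) (τδ := τδ) D (measurable_one.indicator hS)
  simpa only [lintegral_indicator_one hS] using this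

/-- One more backward step, through round `0`, whose history is empty and hence has no hits. -/
theorem targetCharging_preimage_le (ha0 : 0 ≤ a) (ha1 : a ≤ 1)
    (hδ : ∀ m, 0 ≤ K.delta m ∧ K.delta m < 1)
    (htarget : ∀ m, IsTargetOfPair q ε (K.delta m) {y | (m, y) ∈ K.target}
      (K.alg D₀ m) (K.alg D₁ m))
    (hw : IsLossPotential Y ε w) (hG : ∀ c < τ, 1 ≤ G * ENNReal.ofReal a ^ c)
    {N : ℕ} {B : Set (Iic N → Round M Y)} (hB : MeasurableSet B) (k : ℕ) (x : ℝ≥0∞) :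
    targetCharging K A τ τδ D₀ (frestrictLe (π := fun _ => Round M Y) N ⁻¹' B) ≤
      x * targetCharging K A τ τδ D₁ (frestrictLe (π := fun _ => Round M Y) N ⁻¹' B) +
      ∫⁻ ω, ∑' i, ENNReal.ofReal (K.charge (ω i)) ∂targetCharging K A τ τδ D₀ +
      G * ENNReal.ofReal (1 - q + q * a) ^ k + w k x := by
  have hS : MeasurableSet (frestrictLe (π := fun _ => Round M Y) N ⁻¹' B) :=
    measurable_frestrictLe N hB
  have mconst : Measurable fun (z : Round M Y) (_ : Iic 0) => z := by fun_prop
  have e : ∫⁻ ω, ∑' i, ENNReal.ofReal (K.charge (ω i)) ∂targetCharging K A τ τδ D₀ =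
      ∫⁻ z, ENNReal.ofReal (K.charge z) + A.futureCharge K τ τδ D₀ 0 (fun _ => z)
        ∂A.firstRound K τ τδ D₀ := by
    have m := measurable_tsum_charge K 0
    simp only [zero_add] at m
    rw [A.lintegral_targetCharging D₀ m]
    refine lintegral_congr fun z => ?_
    rw [← A.lintegral_tsum_charge K τ τδ D₀ 0 (fun _ => z)]
    simp only [zero_add]
  rw [A.targetCharging_apply D₀ hS, A.targetCharging_apply D₁ hS, e]
  have e0 : K.hits (Fin.elim0 : Fin 0 → Round M Y) = 0 := by simp [Requests.hits]
  have key := K.lintegral_round_le (τδ := τδ) ha0 ha1 hδ htarget hw hG A.first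
    (Fin.elim0 : Fin 0 → Round M Y)
    (u₀ := fun z => A.run K τ τδ D₀ 0 (fun _ => z)
      (frestrictLe (π := fun _ => Round M Y) N ⁻¹' B))
    (u₁ := fun z => A.run K τ τδ D₁ 0 (fun _ => z)
      (frestrictLe (π := fun _ => Round M Y) N ⁻¹' B))
    (r := fun z => A.futureCharge K τ τδ D₀ 0 (fun _ => z))
    (fun z => prob_le_one)
    (((A.run K τ τδ D₀ 0).measurable_coe hS).comp mconst)
    (((A.run K τ τδ D₁ 0).measurable_coe hS).comp mconst)
    ((A.measurable_futureCharge K τ τδ D₀ 0).comp mconst)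
    (fun k x z => by
      classical
      have := A.run_preimage_le (τδ := τδ) ha0 ha1 hδ htarget hw hG hB N 0 (zero_add N)
        (fun _ => z) k x
      rw [e0, zero_add]
      convert this using 5
      simp [Requests.hits]) k x
  rw [e0, pow_zero, mul_one] at key
  exact key

end Analyst

end Interaction

/-! ### Real inequalities behind the constants. -/

/-- The right side is `sinh (log (1 + α))`, and `t ≤ sinh t` for `t ≥ 0`. -/
theorem Real.log_one_add_le {α : ℝ} (hα : 0 ≤ α) :
    Real.log (1 + α) ≤ α - α ^ 2 / (2 * (1 + α)) := by
  have h := Real.self_le_sinh_iff.2 (Real.log_nonneg (by linarith : (1 : ℝ) ≤ 1 + α))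
  rw [Real.sinh_log (by linarith)] at h
  refine h.trans (le_of_eq ?_)
  field_simp
  ring

/-- A Chernoff bound with `b ≤ exp (-q α / (1 + α))`. Rounding the budget down costs at most `α / (1
+ α) ≤ log (1 + α)` in the exponent, which is repaid by the power being `τ - 1` instead of `τ`. -/
theorem Real.one_add_pow_mul_pow_floor_le {α q : ℝ} {τ : ℕ} (hα : 0 < α) (hq : 0 < q)
    (hq1 : q ≤ 1) (hτ : 1 ≤ τ) :
    (1 + α) ^ (τ - 1) * (1 - q + q * (1 + α)⁻¹) ^ ⌊(1 + α) * (τ / q)⌋₊ ≤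
      Real.exp (-(α ^ 2 / (2 * (1 + α))) * τ) := by
  set N := ⌊(1 + α) * (τ / q)⌋₊
  have h1 : (0 : ℝ) < 1 + α := by linarith
  have hN : (1 + α) * (τ / q) - 1 ≤ N := by
    have := Nat.lt_floor_add_one ((1 + α) * (τ / q))
    linarith
  have hb : 1 - q + q * (1 + α)⁻¹ ≤ Real.exp (-(q * (α / (1 + α)))) := by
    have := Real.add_one_le_exp (-(q * (α / (1 + α))))
    refine le_trans (le_of_eq ?_) this
    field_simp
    ring
  have hb0 : 0 ≤ 1 - q + q * (1 + α)⁻¹ := by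
    have : 0 ≤ q * (1 + α)⁻¹ := by positivity
    linarith
  have hτ' : ((τ - 1 : ℕ) : ℝ) = τ - 1 := by
    rw [Nat.cast_sub hτ, Nat.cast_one]
  calc (1 + α) ^ (τ - 1) * (1 - q + q * (1 + α)⁻¹) ^ N
      ≤ Real.exp (Real.log (1 + α)) ^ (τ - 1) * Real.exp (-(q * (α / (1 + α)))) ^ N := by
        rw [Real.exp_log h1]
        gcongr
    _ = Real.exp ((τ - 1) * Real.log (1 + α) - N * (q * (α / (1 + α)))) := by
        rw [← Real.exp_nat_mul, ← Real.exp_nat_mul, ← Real.exp_add, hτ']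
        ring_nf
    _ ≤ Real.exp (-(α ^ 2 / (2 * (1 + α))) * τ) := by
        apply Real.exp_le_exp.2
        have e1 : ((1 + α) * (τ / q) - 1) * (q * (α / (1 + α))) = α * τ - q * (α / (1 + α)) := by
          field_simp
        have e2 : ((1 + α) * (τ / q) - 1) * (q * (α / (1 + α))) ≤ N * (q * (α / (1 + α))) := by
          gcongr
        have e3 : q * (α / (1 + α)) ≤ 1 * (α / (1 + α)) := by gcongr
        have e4 : α / (1 + α) ≤ Real.log (1 + α) := by
          have := Real.one_sub_inv_le_log_of_pos h1
          refine le_trans (le_of_eq ?_) this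
          field_simp
          ring
        have e5 : τ * Real.log (1 + α) ≤ τ * (α - α ^ 2 / (2 * (1 + α))) := by
          gcongr
          exact Real.log_one_add_le hα.le
        linarith

theorem Real.sinh_le_mul_cosh {x : ℝ} (hx : 0 ≤ x) : Real.sinh x ≤ x * Real.cosh x := by
  have hd : ∀ y : ℝ, HasDerivAt (fun y => y * Real.cosh y - Real.sinh y) (y * Real.sinh y) y :=
    fun y => by
      refine (((hasDerivAt_id' y).mul (Real.hasDerivAt_cosh y)).sub
        (Real.hasDerivAt_sinh y)).congr_deriv ?_
      ring
  have hm : MonotoneOn (fun y : ℝ => y * Real.cosh y - Real.sinh y) (Set.Ici 0) := by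
    refine monotoneOn_of_hasDerivWithinAt_nonneg (convex_Ici 0)
      (fun y _ => (hd y).continuousAt.continuousWithinAt)
      (fun y _ => (hd y).hasDerivWithinAt) fun y hy => ?_
    rw [interior_Ici] at hy
    exact mul_nonneg (le_of_lt hy) (Real.sinh_nonneg_iff.2 (le_of_lt hy))
  have := hm (Set.mem_Ici.2 le_rfl) (Set.mem_Ici.2 hx) hx
  simp only [Real.sinh_zero, zero_mul, sub_zero] at this
  linarith

/-- `cosh y * exp (-y² / 2)` decreases on `y ≥ 0`, since `sinh y ≤ y cosh y`. -/
theorem Real.cosh_le_cosh_mul_exp {u v : ℝ} (hv : 0 ≤ v) (huv : v ≤ u) :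
    Real.cosh u ≤ Real.cosh v * Real.exp ((u ^ 2 - v ^ 2) / 2) := by
  have hd : ∀ y : ℝ, HasDerivAt (fun y => Real.cosh y * Real.exp (-(y ^ 2 / 2)))
      ((Real.sinh y - y * Real.cosh y) * Real.exp (-(y ^ 2 / 2))) y := fun y => by
    have h2 : HasDerivAt (fun y : ℝ => -(y ^ 2 / 2)) (-y) y := by
      refine ((hasDerivAt_pow 2 y).div_const 2).neg.congr_deriv ?_
      norm_num
    refine ((Real.hasDerivAt_cosh y).mul h2.exp).congr_deriv ?_
    ring
  have hm : AntitoneOn (fun y : ℝ => Real.cosh y * Real.exp (-(y ^ 2 / 2))) (Set.Ici 0) := by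
    refine antitoneOn_of_hasDerivWithinAt_nonpos (convex_Ici 0)
      (fun y _ => (hd y).continuousAt.continuousWithinAt)
      (fun y _ => (hd y).hasDerivWithinAt) fun y hy => ?_
    rw [interior_Ici] at hy
    exact mul_nonpos_of_nonpos_of_nonneg
      (sub_nonpos.2 (Real.sinh_le_mul_cosh (le_of_lt hy))) (Real.exp_pos _).le
  have h := hm (Set.mem_Ici.2 hv) (Set.mem_Ici.2 (hv.trans huv)) huv
  simp only at h
  calc Real.cosh u = Real.cosh u * Real.exp (-(u ^ 2 / 2)) * Real.exp (u ^ 2 / 2) := by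
        rw [mul_assoc, ← Real.exp_add]; simp
    _ ≤ Real.cosh v * Real.exp (-(v ^ 2 / 2)) * Real.exp (u ^ 2 / 2) := by gcongr
    _ = _ := by rw [mul_assoc, ← Real.exp_add]; ring_nf

/-- The value at `1` of the chord of `x ↦ x ^ s` through `exp (-ε)` and `exp ε`. -/
theorem Real.chord_exp_le {ε s : ℝ} (hε : 0 < ε) (hs : 1 ≤ s) :
    Real.exp (-(s * ε)) + (Real.exp (s * ε) - Real.exp (-(s * ε))) /
      (Real.exp ε - Real.exp (-ε)) * (1 - Real.exp (-ε)) ≤ Real.exp (s * (s - 1) * ε ^ 2 / 2) := by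
  -- The chord value equals `cosh ((s - 1/2) ε) / cosh (ε / 2)`. After substituting `a = exp (ε /
  -- 2)` and `b = exp (s ε)` this is a rational identity.
  have h := Real.cosh_le_cosh_mul_exp (u := (s - 1 / 2) * ε) (v := ε / 2) (by positivity)
    (by nlinarith)
  rw [show (((s - 1 / 2) * ε) ^ 2 - (ε / 2) ^ 2) / 2 = s * (s - 1) * ε ^ 2 / 2 by ring] at h
  rw [← div_le_iff₀' (Real.cosh_pos _)] at h
  refine le_trans (le_of_eq ?_) h
  have e1 : (s - 1 / 2) * ε = s * ε - ε / 2 := by ring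
  have e2 : Real.exp ε = Real.exp (ε / 2) ^ 2 := by rw [← Real.exp_nat_mul]; ring_nf
  rw [Real.cosh_eq, Real.cosh_eq, e1, neg_sub, Real.exp_sub, Real.exp_sub, Real.exp_neg,
    Real.exp_neg, Real.exp_neg, e2]
  have ha : 1 < Real.exp (ε / 2) := Real.one_lt_exp_iff.2 (by positivity)
  have hb := Real.exp_pos (s * ε)
  generalize Real.exp (ε / 2) = a at *
  generalize Real.exp (s * ε) = b at *
  have h5 : a ^ 4 - 1 ≠ 0 := (sub_pos.2 (one_lt_pow₀ ha (by norm_num))).ne'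
  have h6 : a ^ 2 - (a ^ 2)⁻¹ = (a ^ 4 - 1) / a ^ 2 := by field_simp
  rw [h6]
  field_simp
  ring

/-! ### The two loss potentials: basic and advanced composition. -/

section LossPotential

variable {Y : Type*} [MeasurableSpace Y]

theorem Indist.rnDeriv_le {ε : ℝ} {P Q : Measure Y} [IsFiniteMeasure P] [IsFiniteMeasure Q]
    (h : Indist ε 0 P Q) : ∀ᵐ y ∂Q, P.rnDeriv Q y ≤ ENNReal.ofReal (Real.exp ε) := by
  refine ae_le_of_forall_setLIntegral_le_of_sigmaFinite (Measure.measurable_rnDeriv _ _)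
    fun S hS _ => ?_
  rw [setLIntegral_const]
  exact (Measure.setLIntegral_rnDeriv_le S).trans (Measure.le_iff.1 h.le_smul S hS)

theorem Indist.le_rnDeriv {ε : ℝ} {P Q : Measure Y} [IsFiniteMeasure P] [IsFiniteMeasure Q]
    (h : Indist ε 0 P Q) : ∀ᵐ y ∂Q, ENNReal.ofReal (Real.exp (-ε)) ≤ P.rnDeriv Q y := by
  refine ae_le_of_forall_setLIntegral_le_of_sigmaFinite measurable_const fun S hS _ => ?_
  rw [setLIntegral_const, Measure.setLIntegral_rnDeriv h.absolutelyContinuous]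
  calc ENNReal.ofReal (Real.exp (-ε)) * Q S
      ≤ ENNReal.ofReal (Real.exp (-ε)) * (ENNReal.ofReal (Real.exp ε) * P S) := by
        gcongr
        exact Measure.le_iff.1 h.symm.le_smul S hS
    _ = P S := by
        rw [← mul_assoc, ← ENNReal.ofReal_mul (Real.exp_pos _).le, ← Real.exp_add]
        simp

open Classical in
-- Almost surely `ρ ≤ exp ε`, so one call lowers the allowance by a factor of at most `exp ε` and
-- cannot cross the threshold.
theorem isLossPotential_pure {ε : ℝ} (hε : 0 ≤ ε) :
    IsLossPotential Y ε fun k x => if x < ENNReal.ofReal (Real.exp (k * ε)) then 1 else 0 where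
  one_le k x hx := by
    have : (1 : ℝ≥0∞) ≤ ENNReal.ofReal (Real.exp (k * ε)) := by
      rw [ENNReal.one_le_ofReal]
      exact Real.one_le_exp (by positivity)
    rw [if_pos (hx.trans_le this)]
  lintegral_le P Q _ _ h k x := by
    by_cases hx : x < ENNReal.ofReal (Real.exp ((k + 1 : ℕ) * ε))
    · rw [if_pos hx]
      refine lintegral_le_one_of_le_one fun y => ?_
      split_ifs <;> simp
    · rw [if_neg hx, nonpos_iff_eq_zero]
      rw [not_lt] at hx
      refine (lintegral_congr_ae (g := fun _ => 0) ?_).trans lintegral_zero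
      filter_upwards [h.absolutelyContinuous.ae_le h.rnDeriv_le] with y hy
      refine if_neg ?_
      rw [not_lt, ENNReal.le_div_iff_mul_le]
      · refine le_trans ?_ hx
        calc _ ≤ ENNReal.ofReal (Real.exp (k * ε)) * ENNReal.ofReal (Real.exp ε) := by gcongr
          _ = _ := by
            rw [← ENNReal.ofReal_mul (Real.exp_pos _).le, ← Real.exp_add]
            push_cast
            ring_nf
      · exact Or.inr ((ENNReal.ofReal_pos.2 (Real.exp_pos _)).trans_le hx).ne'
      · exact Or.inl (hy.trans_lt ENNReal.ofReal_lt_top).ne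

/-- Passing from `P` to `Q` raises the exponent to `s = l + 1`. By convexity `ρ ^ s` lies below its
chord on `[exp (-ε), exp ε]`, and since `ρ` has `Q`-mean `1` the integral is at most the chord's
value at `1`. -/
theorem Indist.lintegral_rnDeriv_rpow_le {ε l : ℝ} (hε : 0 < ε) (hl : 0 ≤ l) {P Q : Measure Y}
    [IsProbabilityMeasure P] [IsProbabilityMeasure Q] (h : Indist ε 0 P Q) :
    ∫⁻ y, P.rnDeriv Q y ^ l ∂P ≤ ENNReal.ofReal (Real.exp (l * (l + 1) * ε ^ 2 / 2)) := by
  set s := l + 1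
  set m := Real.exp (-ε)
  set M := Real.exp ε
  have hmM : m < M := Real.exp_lt_exp.2 (by linarith)
  have hm : 0 < m := Real.exp_pos _
  have hms : m ^ s = Real.exp (-(s * ε)) := by rw [← Real.exp_mul]; ring_nf
  have hMs : M ^ s = Real.exp (s * ε) := by rw [← Real.exp_mul]; ring_nf
  set c := (M ^ s - m ^ s) / (M - m)
  have chord : ∀ r ∈ Set.Icc m M, r ^ s ≤ m ^ s + c * (r - m) := fun r hr => by
    have hd : 0 < M - m := sub_pos.2 hmM
    have := (convexOn_rpow (by linarith : (1 : ℝ) ≤ s)).2 (Set.mem_Ici.2 hm.le)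
      (Set.mem_Ici.2 (hm.trans hmM).le) 
      (div_nonneg (sub_nonneg.2 hr.2) hd.le) (div_nonneg (sub_nonneg.2 hr.1) hd.le)
      (by field_simp; ring)
    simp only [smul_eq_mul] at this
    have e1 : (M - r) / (M - m) * m + (r - m) / (M - m) * M = r := by field_simp; ring
    have e2 : (M - r) / (M - m) * m ^ s + (r - m) / (M - m) * M ^ s = m ^ s + c * (r - m) := by
      simp only [c]
      field_simp
      ring
    rwa [e1, e2] at this
  have hQ : ∀ᵐ y ∂Q, (P.rnDeriv Q y).toReal ∈ Set.Icc m M := by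
    filter_upwards [h.rnDeriv_le, h.le_rnDeriv] with y h1 h2
    exact ⟨(ENNReal.ofReal_le_iff_le_toReal (h1.trans_lt ENNReal.ofReal_lt_top).ne).1 h2,
      ENNReal.toReal_le_of_le_ofReal (Real.exp_pos _).le h1⟩
  have hint : Integrable (fun y => m ^ s + c * ((P.rnDeriv Q y).toReal - m)) Q :=
    (integrable_const _).add ((Measure.integrable_toReal_rnDeriv.sub (integrable_const _)).const_mul _)
  rw [← lintegral_rnDeriv_mul h.absolutelyContinuous
    ((Measure.measurable_rnDeriv P Q).pow_const l).aemeasurable]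
  calc ∫⁻ y, P.rnDeriv Q y * P.rnDeriv Q y ^ l ∂Q
      ≤ ∫⁻ y, ENNReal.ofReal (m ^ s + c * ((P.rnDeriv Q y).toReal - m)) ∂Q := by
        refine lintegral_mono_ae ?_
        filter_upwards [hQ, h.rnDeriv_le] with y hy h1
        have hfin : P.rnDeriv Q y ≠ ∞ := (h1.trans_lt ENNReal.ofReal_lt_top).ne
        have hpos : 0 < (P.rnDeriv Q y).toReal := hm.trans_le hy.1
        refine le_trans (le_of_eq ?_) (ENNReal.ofReal_le_ofReal (chord _ hy))
        rw [Real.rpow_add hpos, Real.rpow_one, ENNReal.ofReal_mul (by positivity),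
          ← ENNReal.ofReal_rpow_of_pos hpos, ENNReal.ofReal_toReal hfin, mul_comm]
    _ = ENNReal.ofReal (∫ y, m ^ s + c * ((P.rnDeriv Q y).toReal - m) ∂Q) := by
        rw [ofReal_integral_eq_lintegral_ofReal hint]
        filter_upwards [hQ] with y hy
        exact (Real.rpow_nonneg (hm.le.trans hy.1) s).trans (chord _ hy)
    _ ≤ _ := by
        have hi : Integrable (fun y => c * ((P.rnDeriv Q y).toReal - m)) Q :=
          (Measure.integrable_toReal_rnDeriv.sub (integrable_const _)).const_mul _
        rw [integral_add (integrable_const _) hi,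
          integral_const_mul, integral_sub Measure.integrable_toReal_rnDeriv (integrable_const _),
          Measure.integral_toReal_rnDeriv h.absolutelyContinuous]
        apply ENNReal.ofReal_le_ofReal
        have := Real.chord_exp_le hε (by linarith : 1 ≤ s)
        simp only [integral_const, probReal_univ, one_smul, c, hms, hMs]
        refine this.trans (le_of_eq ?_)
        simp only [s]
        ring_nf

/-- Markov's inequality for the `l`-th power of the likelihood ratio; each call contributes one
moment factor, because `(x / ρ) ^ (-l) = x ^ (-l) * ρ ^ l` almost surely. -/
theorem isLossPotential_renyi {ε l : ℝ} (hε : 0 < ε) (hl : 0 ≤ l) :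
    IsLossPotential Y ε fun k x =>
      ENNReal.ofReal (Real.exp (k * (l * (l + 1) * ε ^ 2 / 2))) * x ^ (-l) where
  one_le k x hx := by
    have h1 : (1 : ℝ≥0∞) ≤ ENNReal.ofReal (Real.exp (k * (l * (l + 1) * ε ^ 2 / 2))) := by
      rw [ENNReal.one_le_ofReal]
      exact Real.one_le_exp (by positivity)
    have h2 : 1 ≤ x ^ (-l) := by
      rw [ENNReal.rpow_neg, ENNReal.one_le_inv]
      exact ENNReal.rpow_le_one hx.le hl
    exact one_le_mul h1 h2
  lintegral_le P Q _ _ h k x := by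
    have e : ∀ᵐ y ∂P, ENNReal.ofReal (Real.exp (k * (l * (l + 1) * ε ^ 2 / 2))) *
        (x / P.rnDeriv Q y) ^ (-l) = ENNReal.ofReal (Real.exp (k * (l * (l + 1) * ε ^ 2 / 2))) *
          x ^ (-l) * P.rnDeriv Q y ^ l := by
      filter_upwards [h.absolutelyContinuous.ae_le h.rnDeriv_le,
        h.absolutelyContinuous.ae_le h.le_rnDeriv] with y h1 h2
      have hfin : P.rnDeriv Q y ≠ ∞ := (h1.trans_lt ENNReal.ofReal_lt_top).ne
      have hpos : P.rnDeriv Q y ≠ 0 := ((ENNReal.ofReal_pos.2 (Real.exp_pos _)).trans_le h2).ne'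
      rw [div_eq_mul_inv x, ENNReal.mul_rpow_eq_ite, if_neg (by simp [hfin, hpos]),
        ENNReal.inv_rpow, ENNReal.rpow_neg (P.rnDeriv Q y), inv_inv, ← mul_assoc]
    rw [lintegral_congr_ae e,
      lintegral_const_mul _ ((Measure.measurable_rnDeriv P Q).pow_const l)]
    calc _ ≤ ENNReal.ofReal (Real.exp (k * (l * (l + 1) * ε ^ 2 / 2))) * x ^ (-l) *
          ENNReal.ofReal (Real.exp (l * (l + 1) * ε ^ 2 / 2)) := by
          gcongr
          exact h.lintegral_rnDeriv_rpow_le hε hl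
      _ = _ := by
          rw [mul_right_comm, ← ENNReal.ofReal_mul (Real.exp_pos _).le, ← Real.exp_add]
          push_cast
          ring_nf

end LossPotential

/-! ### Passage to all events and choice of parameters. -/

open Finset Preorder in
/-- An approximate multiplicative bound on the sets that depend on finitely many coordinates holds
on all measurable sets. -/
theorem measure_le_of_preimage_frestrictLe_le {R : Type*} [MeasurableSpace R]
    {P Q : Measure (ℕ → R)} [IsProbabilityMeasure P] [IsProbabilityMeasure Q] {x d : ℝ≥0∞}
    (hx : x ≠ ∞)
    (h : ∀ (N : ℕ) (B : Set (Iic N → R)), MeasurableSet B →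
      P (frestrictLe (π := fun _ => R) N ⁻¹' B) ≤
        x * Q (frestrictLe (π := fun _ => R) N ⁻¹' B) + d)
    {S : Set (ℕ → R)} (hS : MeasurableSet S) : P S ≤ x * Q S + d := by
  have key : ∀ η : ℝ≥0∞, 0 < η → P S ≤ x * Q S + d + (1 + x) * η := fun η hη => by
    -- Approximating with respect to `P + Q` gives a single cylinder that is close to `S` under both
    -- measures.
    obtain ⟨t, ht, htS⟩ := exists_measure_symmDiff_lt_of_generateFrom_isSetRing (μ := P + Q)
      (isSetRing_measurableCylinders (α := fun _ : ℕ => R))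
      ⟨{Set.univ}, Set.countable_singleton _,
        Set.singleton_subset_iff.2
          (isSetAlgebra_measurableCylinders (α := fun _ : ℕ => R)).univ_mem, by simp⟩
      generateFrom_measurableCylinders.symm hS hη
    obtain ⟨N, B, hB, rfl⟩ : ∃ N B, MeasurableSet B ∧ t = cylinder (Iic N) B := by
      simpa [measurableCylinders_nat] using ht
    set t : Set (ℕ → R) := cylinder (Iic N) B
    rw [Measure.add_apply] at htS
    have h1 : P S ≤ P t + η := by
      have hsub : S ⊆ t ∪ symmDiff t S := fun ω hω => by
        by_cases hωt : ω ∈ t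
        · exact Or.inl hωt
        · exact Or.inr (Or.inr ⟨hω, hωt⟩)
      calc P S ≤ P t + P (symmDiff t S) := (measure_mono hsub).trans (measure_union_le _ _)
        _ ≤ P t + η := by
          gcongr
          exact le_self_add.trans htS.le
    have h2 : Q t ≤ Q S + η := by
      have hsub : t ⊆ S ∪ symmDiff t S := fun ω hω => by
        by_cases hωt : ω ∈ S
        · exact Or.inl hωt
        · exact Or.inr (Or.inl ⟨hω, hωt⟩)
      calc Q t ≤ Q S + Q (symmDiff t S) := (measure_mono hsub).trans (measure_union_le _ _)
        _ ≤ Q S + η := by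
          gcongr
          exact le_add_self.trans htS.le
    calc P S ≤ P t + η := h1
      _ ≤ x * Q t + d + η := by gcongr; exact h N B hB
      _ ≤ x * (Q S + η) + d + η := by gcongr
      _ = _ := by ring
  rcases eq_or_ne d ∞ with rfl | hd
  · simp
  refine ENNReal.le_of_forall_pos_le_add fun η hη _ => ?_
  have h1x : 1 + x ≠ ∞ := ENNReal.add_ne_top.2 ⟨ENNReal.one_ne_top, hx⟩
  have h1x0 : 1 + x ≠ 0 := by simp
  have := key (η / (1 + x)) (ENNReal.div_pos (by exact_mod_cast hη.ne') h1x)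
  rwa [ENNReal.mul_div_cancel h1x0 h1x] at this

section Main

variable {𝒟 M Y : Type*} [MeasurableSpace M] [MeasurableSpace Y]

theorem lintegral_tsum_charge_le {K : Requests 𝒟 M Y} (hδ : ∀ m, 0 ≤ K.delta m)
    {P : Measure (ℕ → Round M Y)} [IsProbabilityMeasure P] {c : ℝ}
    (hP : ∀ᵐ ω ∂P, SpentAtMost K c ω) :
    ∫⁻ ω, ∑' i, ENNReal.ofReal (K.charge (ω i)) ∂P ≤ ENNReal.ofReal c := by
  have hc : ∀ r, 0 ≤ K.charge r := fun ⟨m, y⟩ => by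
    rcases y with y | y
    · exact hδ m
    · exact le_rfl
  calc _ ≤ ∫⁻ _, ENNReal.ofReal c ∂P := by
        refine lintegral_mono_ae ?_
        filter_upwards [hP] with ω hω
        refine ENNReal.tsum_le_of_sum_range_le fun n => ?_
        rw [← ENNReal.ofReal_sum_of_nonneg fun i _ => hc _, Finset.sum_range]
        exact ENNReal.ofReal_le_ofReal (hω n)
    _ = _ := by simp

theorem SpentAtMost.nonneg {K : Requests 𝒟 M Y} {P : Measure (ℕ → Round M Y)}
    [IsProbabilityMeasure P] {c : ℝ} (hP : ∀ᵐ ω ∂P, SpentAtMost K c ω) : 0 ≤ c := by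
  obtain ⟨ω, hω⟩ := hP.exists
  simpa [Requests.spent] using hω 0

theorem measureReal_targetCharging_le {q ε : ℝ} (hq : 0 < q) (hq1 : q ≤ 1) {τ : ℕ} (hτ : 1 ≤ τ)
    {τδ : ℝ} {K : Requests 𝒟 M Y} (hδ : ∀ m, 0 ≤ K.delta m ∧ K.delta m < 1) {D₀ D₁ : 𝒟}
    (htarget : ∀ m, IsTargetOfPair q ε (K.delta m) {y | (m, y) ∈ K.target}
      (K.alg D₀ m) (K.alg D₁ m)) (A : Analyst M Y) {Cδ : ℝ}
    (hC : ∀ᵐ ω ∂targetCharging K A τ τδ D₀, SpentAtMost K Cδ ω) {α : ℝ} (hα : 0 < α)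
    {w : ℕ → ℝ≥0∞ → ℝ≥0∞} (hw : IsLossPotential Y ε w) {e δ : ℝ} (hδ0 : 0 ≤ δ)
    (hwe : w ⌊(1 + α) * (τ / q)⌋₊ (ENNReal.ofReal (Real.exp e)) ≤ ENNReal.ofReal δ)
    {S : Set (ℕ → Round M Y)} (hS : MeasurableSet S) :
    (targetCharging K A τ τδ D₀).real S ≤ Real.exp e * (targetCharging K A τ τδ D₁).real S +
      (δ + Cδ + Real.exp (-(α ^ 2 / (2 * (1 + α))) * τ)) := by
  have h1α : 0 < 1 + α := by linarith
  have hC0 : 0 ≤ Cδ := SpentAtMost.nonneg hC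
  -- The parameters are `a = (1 + α)⁻¹` and `G = a ^ (-(τ - 1))`; the exponent `τ - 1` suffices
  -- because a published round starts with at most `τ - 1` hits.
  have hG : ∀ c < τ, 1 ≤ ENNReal.ofReal ((1 + α) ^ (τ - 1)) * ENNReal.ofReal (1 + α)⁻¹ ^ c := by
    intro c hc
    rw [← ENNReal.ofReal_pow (by positivity), ← ENNReal.ofReal_mul (by positivity),
      ENNReal.one_le_ofReal, inv_pow, ← div_eq_mul_inv, one_le_div (by positivity)]
    exact pow_le_pow_right₀ (by linarith) (by omega)
  have hb0 : 0 ≤ 1 - q + q * (1 + α)⁻¹ := by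
    have : 0 ≤ q * (1 + α)⁻¹ := by positivity
    linarith
  have key := measure_le_of_preimage_frestrictLe_le (P := targetCharging K A τ τδ D₀)
    (Q := targetCharging K A τ τδ D₁) (x := ENNReal.ofReal (Real.exp e))
    (d := ENNReal.ofReal (δ + Cδ + Real.exp (-(α ^ 2 / (2 * (1 + α))) * τ))) ENNReal.ofReal_ne_top
    (fun N B hB => by
      refine (A.targetCharging_preimage_le (by positivity) (inv_le_one_of_one_le₀ (by linarith)) hδ
        htarget hw hG hB ⌊(1 + α) * (τ / q)⌋₊ (ENNReal.ofReal (Real.exp e))).trans ?_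
      rw [add_assoc, add_assoc]
      gcongr
      rw [ENNReal.ofReal_add (by positivity) (Real.exp_pos _).le, ENNReal.ofReal_add hδ0 hC0,
        add_comm (ENNReal.ofReal δ), add_assoc, add_comm (ENNReal.ofReal δ)]
      gcongr
      · exact lintegral_tsum_charge_le (fun m => (hδ m).1) hC
      · rw [← ENNReal.ofReal_pow hb0, ← ENNReal.ofReal_mul (by positivity)]
        exact ENNReal.ofReal_le_ofReal (Real.one_add_pow_mul_pow_floor_le hα hq hq1 hτ)) hS
  rw [← ofReal_measureReal, ← ofReal_measureReal, ← ENNReal.ofReal_mul (Real.exp_pos _).le,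
    ← ENNReal.ofReal_add (by positivity) (by positivity)] at key
  exact (ENNReal.ofReal_le_ofReal_iff (by positivity)).1 key

/-- With `s = √(2 c log (1 / δ))`, the order `l = s / (c ε)` minimizes `c l (l + 1) ε² / 2 - l e`
for `e = c ε² / 2 + ε s`; the minimum is `-s² / (2 c) = log δ`. -/
theorem renyi_tail_le {ε δ c : ℝ} {N : ℕ} (hε : 0 < ε) (hδ : 0 < δ) (hδ1 : δ < 1) (hc : 0 < c)
    (hN : N ≤ c) :
    N * (Real.sqrt (2 * c * Real.log (1 / δ)) / (c * ε) *
        (Real.sqrt (2 * c * Real.log (1 / δ)) / (c * ε) + 1) * ε ^ 2 / 2) -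
      Real.sqrt (2 * c * Real.log (1 / δ)) / (c * ε) *
        (1 / 2 * c * ε ^ 2 + ε * Real.sqrt (2 * c * Real.log (1 / δ))) ≤ Real.log δ := by
  have hlog : 0 ≤ Real.log (1 / δ) := Real.log_nonneg (by rw [le_div_iff₀ hδ]; linarith)
  have hs := Real.sq_sqrt (show 0 ≤ 2 * c * Real.log (1 / δ) by positivity)
  set s := Real.sqrt (2 * c * Real.log (1 / δ))
  have hs0 : 0 ≤ s := Real.sqrt_nonneg _
  have h1 : (N : ℝ) * (s / (c * ε) * (s / (c * ε) + 1) * ε ^ 2 / 2) ≤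
      c * (s / (c * ε) * (s / (c * ε) + 1) * ε ^ 2 / 2) := by gcongr
  have h2 : c * (s / (c * ε) * (s / (c * ε) + 1) * ε ^ 2 / 2) -
      s / (c * ε) * (1 / 2 * c * ε ^ 2 + ε * s) = -(s ^ 2 / (2 * c)) := by
    field_simp
    ring
  have h3 : s ^ 2 / (2 * c) = -Real.log δ := by
    rw [hs, one_div, Real.log_inv]
    field_simp
  linarith

end Main

/-! ### The limit on the cumulative `δ`-parameter is respected. -/

section Spent

open Finset Preorder

variable {𝒟 M Y : Type*} [MeasurableSpace M] [MeasurableSpace Y]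

namespace Requests

variable (K : Requests 𝒟 M Y) {ι : Type*} [Fintype ι] (τ : ℕ) (τδ : ℝ) (D : 𝒟)

/-- The pairs of a history and a next round that respect the halting rule. -/
def admissibleSet : Set ((ι → Round M Y) × Round M Y) :=
  {p | p.2.2 ∈ Set.range Sum.inr} ∪ (fun p => (p.1, p.2.1)) ⁻¹' K.publishSet τ τδ

theorem measurableSet_admissibleSet :
    MeasurableSet (K.admissibleSet (ι := ι) τ τδ) := by
  have h1 : Measurable fun p : (ι → Round M Y) × Round M Y => p.2.2 := by fun_prop
  have h2 : Measurable fun p : (ι → Round M Y) × Round M Y => (p.1, p.2.1) := by fun_prop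
  exact (h1 measurableSet_range_inr).union (h2 (K.measurableSet_publishSet τ τδ))

/-- Outside `publishSet` the reply is the point mass at `Sum.inr ()`, so outcomes are almost surely
published only where the rule allows it. -/
theorem ae_mem_admissibleSet (ν : Measure M) [IsProbabilityMeasure ν] (h : ι → Round M Y) :
    ∀ᵐ z ∂(ν ⊗ₘ (K.reply τ τδ D).sectR h), (h, z) ∈ K.admissibleSet τ τδ := by
  rw [Measure.ae_compProd_iff
    (measurable_prodMk_left (K.measurableSet_admissibleSet (ι := ι) τ τδ))]
  refine ae_of_all _ fun m => ?_
  rw [Kernel.sectR_apply]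
  by_cases hm : (h, m) ∈ K.publishSet τ τδ
  · exact ae_of_all _ fun y => Or.inr hm
  · have mA : MeasurableSet {y : Y ⊕ Unit | (h, (m, y)) ∈ K.admissibleSet τ τδ} :=
      measurable_prodMk_left (measurable_prodMk_left (K.measurableSet_admissibleSet (ι := ι) τ τδ))
    rw [K.reply_of_notMem D hm]
    exact (ae_dirac_iff mA).2 (Or.inl ⟨(), rfl⟩)

variable {K τ τδ}

theorem spent_add_charge_le {h : ι → Round M Y} {z : Round M Y}
    (hz : (h, z) ∈ K.admissibleSet τ τδ) (hh : K.spent h ≤ τδ) :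
    K.spent h + K.charge z ≤ τδ := by
  obtain ⟨m, y | y⟩ := z
  · rcases hz with ⟨u, hu⟩ | hz
    · cases hu
    · exact hz.2.2
  · simpa [charge] using hh

end Requests

theorem spentAtMost_targetCharging (K : Requests 𝒟 M Y) (A : Analyst M Y) (τ : ℕ) {τδ : ℝ}
    (hτδ : 0 ≤ τδ) (D : 𝒟) : ∀ᵐ ω ∂targetCharging K A τ τδ D, SpentAtMost K τδ ω := by
  have h0 : ∀ᵐ ω ∂targetCharging K A τ τδ D,
      ((Fin.elim0 : Fin 0 → Round M Y), ω 0) ∈ K.admissibleSet τ τδ := by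
    set B := {z : Round M Y | ((Fin.elim0 : Fin 0 → Round M Y), z) ∈ K.admissibleSet τ τδ}
    have mB : MeasurableSet Bᶜ :=
      (measurable_prodMk_left (K.measurableSet_admissibleSet τ τδ)).compl
    have mf : Measurable (Bᶜ.indicator (1 : Round M Y → ℝ≥0∞)) := measurable_one.indicator mB
    have mf0 : Measurable fun ω : ℕ → Round M Y => Bᶜ.indicator (1 : Round M Y → ℝ≥0∞) (ω 0) :=
      mf.comp (measurable_pi_apply 0)
    have hB : A.firstRound K τ τδ D Bᶜ = 0 := K.ae_mem_admissibleSet τ τδ D A.first Fin.elim0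
    have e : ∫⁻ ω, Bᶜ.indicator (1 : Round M Y → ℝ≥0∞) (ω 0) ∂targetCharging K A τ τδ D = 0 := by
      rw [A.lintegral_targetCharging D mf0, ← hB, ← lintegral_indicator_one mB]
      exact lintegral_congr fun z => lintegral_traj_eval _ _ mf
    filter_upwards [(lintegral_eq_zero_iff mf0).1 e] with ω hω
    by_contra hcon
    have : ω 0 ∈ Bᶜ := hcon
    simp [this] at hω

  have hs : ∀ n, ∀ᵐ ω ∂targetCharging K A τ τδ D,
      (frestrictLe (π := fun _ => Round M Y) n ω, ω (n + 1)) ∈ K.admissibleSet τ τδ := by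
    intro n
    have m : Measurable fun ω : ℕ → Round M Y =>
        (frestrictLe (π := fun _ => Round M Y) n ω, ω (n + 1)) :=
      (measurable_frestrictLe n).prodMk (measurable_pi_apply _)
    have hA := K.measurableSet_admissibleSet (ι := Iic n) τ τδ
    refine (ae_map_iff (p := (· ∈ K.admissibleSet τ τδ)) m.aemeasurable hA).1 ?_
    rw [targetCharging,
      ← Kernel.map_frestrictLe_trajMeasure_compProd_eq_map_trajMeasure (X := fun _ => Round M Y)]
    refine (Measure.ae_compProd_iff (p := (· ∈ K.admissibleSet τ τδ)) hA).2
      (ae_of_all _ fun h => ?_)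
    rw [Analyst.nextRound_apply]
    exact K.ae_mem_admissibleSet τ τδ D (A.next n h) h
  filter_upwards [h0, ae_all_iff.2 hs] with ω hω0 hω n
  induction n with
  | zero => simpa [Requests.spent] using hτδ
  | succ n ih =>
    have e : K.spent (fun i : Fin (n + 1) => ω i) = K.spent (fun i : Fin n => ω i) +
        K.charge (ω n) := by
      simp [Requests.spent, Fin.sum_univ_castSucc]
    rw [e]
    -- Round `0` has a history indexed by `Fin 0`, later rounds one indexed by `Iic n`, so the two
    -- are matched with `Fin` separately.
    rcases n with _ | n
    · have e0 : (fun i : Fin 0 => ω i) = Fin.elim0 := funext fun i => i.elim0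
      rw [e0] at ih ⊢
      exact Requests.spent_add_charge_le hω0 ih
    · have e1 : K.spent (fun i : Fin (n + 1) => ω i) =
          K.spent (frestrictLe (π := fun _ => Round M Y) n ω) := by
        change ∑ i : Fin (n + 1), K.charge (ω i) = ∑ i : Iic n, K.charge (ω i)
        rw [← sum_range (fun i => K.charge (ω i)), sum_coe_sort (Iic n) (fun i => K.charge (ω i)),
          Nat.range_succ_eq_Iic]
      rw [e1] at ih ⊢
      exact Requests.spent_add_charge_le (hω n) ih

end Spent

/-! ### The two one-sided privacy bounds; exchanging the datasets gives the other side. -/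

section Privacy

variable {𝒟 M Y : Type*} [MeasurableSpace M] [MeasurableSpace Y]

theorem measureReal_targetCharging_le_pure {q ε : ℝ} (hq : 0 < q) (hq1 : q ≤ 1) (hε : 0 < ε)
    {τ : ℕ} (hτ : 1 ≤ τ) {τδ : ℝ} {K : Requests 𝒟 M Y}
    (hδ : ∀ m, 0 ≤ K.delta m ∧ K.delta m < 1) {D₀ D₁ : 𝒟}
    (htarget : ∀ m, IsTargetOfPair q ε (K.delta m) {y | (m, y) ∈ K.target}
      (K.alg D₀ m) (K.alg D₁ m)) (A : Analyst M Y) {Cδ : ℝ}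
    (hC : ∀ᵐ ω ∂targetCharging K A τ τδ D₀, SpentAtMost K Cδ ω) {α : ℝ} (hα : 0 < α)
    {S : Set (ℕ → Round M Y)} (hS : MeasurableSet S) :
    (targetCharging K A τ τδ D₀).real S ≤
      Real.exp ((1 + α) * (τ / q) * ε) * (targetCharging K A τ τδ D₁).real S +
        (Cδ + Real.exp (-(α ^ 2 / (2 * (1 + α))) * τ)) := by
  have hN : (⌊(1 + α) * (τ / q)⌋₊ : ℝ) ≤ (1 + α) * (τ / q) := Nat.floor_le (by positivity)
  have := measureReal_targetCharging_le hq hq1 hτ hδ htarget A hC hα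
    (isLossPotential_pure hε.le) (e := (1 + α) * (τ / q) * ε) le_rfl (by
      rw [if_neg]
      · exact zero_le
      · rw [not_lt]
        gcongr) hS
  rwa [zero_add] at this

theorem measureReal_targetCharging_le_advanced {q ε : ℝ} (hq : 0 < q) (hq1 : q ≤ 1) (hε : 0 < ε)
    {τ : ℕ} (hτ : 1 ≤ τ) {τδ : ℝ} {K : Requests 𝒟 M Y}
    (hδ : ∀ m, 0 ≤ K.delta m ∧ K.delta m < 1) {D₀ D₁ : 𝒟}
    (htarget : ∀ m, IsTargetOfPair q ε (K.delta m) {y | (m, y) ∈ K.target}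
      (K.alg D₀ m) (K.alg D₁ m)) (A : Analyst M Y) {Cδ : ℝ}
    (hC : ∀ᵐ ω ∂targetCharging K A τ τδ D₀, SpentAtMost K Cδ ω) {α : ℝ} (hα : 0 < α)
    {δ : ℝ} (hδ0 : 0 < δ) {S : Set (ℕ → Round M Y)} (hS : MeasurableSet S) :
    (targetCharging K A τ τδ D₀).real S ≤
      Real.exp (1 / 2 * (1 + α) * (τ / q) * ε ^ 2 +
          ε * Real.sqrt (2 * (1 + α) * (τ / q) * Real.log (1 / δ))) *
        (targetCharging K A τ τδ D₁).real S +
        (δ + Cδ + Real.exp (-(α ^ 2 / (2 * (1 + α))) * τ)) := by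
  -- For `δ ≥ 1` the additive term alone exceeds every probability, whatever the value of the square
  -- root.
  rcases le_or_gt 1 δ with hδ1 | hδ1
  · have h1 : (targetCharging K A τ τδ D₀).real S ≤ 1 := measureReal_le_one
    have h2 := SpentAtMost.nonneg hC
    have h3 := Real.exp_pos (-(α ^ 2 / (2 * (1 + α))) * τ)
    have h4 : 0 ≤ Real.exp (1 / 2 * (1 + α) * (τ / q) * ε ^ 2 +
        ε * Real.sqrt (2 * (1 + α) * (τ / q) * Real.log (1 / δ))) *
        (targetCharging K A τ τδ D₁).real S := by positivity
    linarith
  · have hτ0 : (0 : ℝ) < τ := by exact_mod_cast hτ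
    have hN : (⌊(1 + α) * (τ / q)⌋₊ : ℝ) ≤ (1 + α) * (τ / q) := Nat.floor_le (by positivity)
    have hc : 0 < (1 + α) * (τ / q) := by positivity
    have key := renyi_tail_le hε hδ0 hδ1 hc hN
    rw [mul_assoc 2 (1 + α), mul_assoc (1 / 2) (1 + α)]
    refine measureReal_targetCharging_le hq hq1 hτ hδ htarget A hC hα
      (isLossPotential_renyi hε
        (l := Real.sqrt (2 * ((1 + α) * (τ / q)) * Real.log (1 / δ)) / ((1 + α) * (τ / q) * ε))
        (by positivity)) hδ0.le ?_ hS
    rw [ENNReal.ofReal_rpow_of_pos (Real.exp_pos _), ← Real.exp_mul,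
      ← ENNReal.ofReal_mul (Real.exp_pos _).le, ← Real.exp_add]
    apply ENNReal.ofReal_le_ofReal
    rw [← Real.le_log_iff_exp_le hδ0]
    refine le_trans (le_of_eq ?_) key
    ring

end Privacy

theorem mainTheorem1 {𝒟 M Y : Type*} [MeasurableSpace M] [MeasurableSpace Y]
    (nbr : 𝒟 → 𝒟 → Prop) (q ε : ℝ) (hq : 0 < q) (hq1 : q ≤ 1) (hε : 0 < ε)
    (τ : ℕ) (hτ : 1 ≤ τ) (τδ : ℝ) (hτδ : 0 ≤ τδ)
    (K : Requests 𝒟 M Y)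
    (hδ : ∀ m, 0 ≤ K.delta m ∧ K.delta m < 1)
    (htarget : ∀ m, IsTarget nbr q ε (K.delta m) {y | (m, y) ∈ K.target} (fun D => K.alg D m))
    (A : Analyst M Y) :
    (∀ D, ∀ᵐ ω ∂(targetCharging K A τ τδ D), SpentAtMost K τδ ω) ∧
    ∀ Cδ : ℝ, (∀ D, ∀ᵐ ω ∂(targetCharging K A τ τδ D), SpentAtMost K Cδ ω) →
      ∀ α : ℝ, 0 < α →
        IsDP nbr ((1 + α) * (τ / q) * ε)
          (Cδ + Real.exp (-(α ^ 2 / (2 * (1 + α))) * τ))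
          (targetCharging K A τ τδ) ∧
        ∀ δ : ℝ, 0 < δ →
          IsDP nbr
            (1 / 2 * (1 + α) * (τ / q) * ε ^ 2
              + ε * Real.sqrt (2 * (1 + α) * (τ / q) * Real.log (1 / δ)))
            (δ + Cδ + Real.exp (-(α ^ 2 / (2 * (1 + α))) * τ))
            (targetCharging K A τ τδ) := by
  refine ⟨spentAtMost_targetCharging K A τ hτδ, fun Cδ hC α hα => ⟨fun D₀ D₁ hD S hS => ?_,
    fun δ hδ0 D₀ D₁ hD S hS => ?_⟩⟩
  · exact ⟨measureReal_targetCharging_le_pure hq hq1 hε hτ hδ (fun m => htarget m D₀ D₁ hD) A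
        (hC D₀) hα hS,
      measureReal_targetCharging_le_pure hq hq1 hε hτ hδ (fun m => (htarget m D₀ D₁ hD).symm) A
        (hC D₁) hα hS⟩
  · exact ⟨measureReal_targetCharging_le_advanced hq hq1 hε hτ hδ
        (fun m => htarget m D₀ D₁ hD) A (hC D₀) hα hδ0 hS,
      measureReal_targetCharging_le_advanced hq hq1 hε hτ hδ
        (fun m => (htarget m D₀ D₁ hD).symm) A (hC D₁) hα hδ0 hS⟩
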